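/- Let $n\in\mathbb N$, let $C$ be a bivariate copula, and let $(U_1,V_1),\dots,(U_n,V_n)$ be independent random vectors, each with distribution function $C$ on $[0,1]^2$ (so that every $U_i$ and every $V_i$ is uniformly distributed on $(0,1)$). Denote by $U_{1:n}\le\dots\le U_{n:n}$ and $V_{1:n}\le\dots\le V_{n:n}$ the componentwise order statistics, and let $1\le k,m\le n$. For $y\in(0,1)$ let $U^{(1)}_1,\dots,U^{(1)}_{k-1},U^{(2)}_1,\dots,U^{(2)}_{n-k}$ be independent random variables with $$P\bigl(U^{(1)}_i\le u\bigr)=P(U_1\le u\mid V_1\le y)=\frac{C(u,y)}{y},\qquad P\bigl(U^{(2)}_i\le u\bigr)=P(U_1\le u\mid V_1>y)=\frac{u-C(u,y)}{1-y},\qquad 0\le u\le 1$$ (such random variables exist and the two conditional probabilities have the stated values), and for $x\in[0,1]$ put $$S=S_{x,y}=\sum_{i=1}^{k-1}1_{[0,x]}\bigl(U^{(1)}_i\bigr)+\sum_{i=1}^{n-k}1_{[0,x]}\bigl(U^{(2)}_i\bigr).$$ Thus $S$ is a sum of $k-1$ Bernoulli indicators with success probability $C(x,y)/y$ and $n-k$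 Bernoulli indicators with success probability $(x-C(x,y))/(1-y)$, all independent. Then for almost every $x,y\in[0,1]$ the partial derivative $\frac{\partial}{\partial y}C(x,y)$ exists and $$P(U_{m:n}\le x\mid V_{k:n}=y)=P(S\ge m)+\frac{\partial}{\partial y}C(x,y)\;P(S=m-1).$$ Here $P(U_{m:n}\le\cdot\mid V_{k:n}=y)$ is the regular conditional distribution function of $U_{m:n}$ given $V_{k:n}=y$, and "almost every $x,y$" means: for every $x\in[0,1]$ and Lebesgue-almost every $y\in[0,1]$, and also for Lebesgue-almost every $(x,y)\in[0,1]^2$. -/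

import Mathlib

open MeasureTheory ProbabilityTheory

/-- A bivariate copula: a function on the unit square that is grounded, has uniform margins and is
2-increasing. Only the values of `C` on `[0,1] × [0,1]` matter. -/
structure IsCopula (C : ℝ → ℝ → ℝ) : Prop where
  zero_left : ∀ v ∈ Set.Icc (0 : ℝ) 1, C 0 v = 0
  zero_right : ∀ u ∈ Set.Icc (0 : ℝ) 1, C u 0 = 0
  one_left : ∀ v ∈ Set.Icc (0 : ℝ) 1, C 1 v = v
  one_right : ∀ u ∈ Set.Icc (0 : ℝ) 1, C u 1 = u
  two_increasing : ∀ u₁ ∈ Set.Icc (0 : ℝ) 1, ∀ u₂ ∈ Set.Icc (0 : ℝ) 1,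
    ∀ v₁ ∈ Set.Icc (0 : ℝ) 1, ∀ v₂ ∈ Set.Icc (0 : ℝ) 1, u₁ ≤ u₂ → v₁ ≤ v₂ →
      0 ≤ C u₂ v₂ - C u₂ v₁ - C u₁ v₂ + C u₁ v₁

/-- The pair `(U, V)` has the distribution function `C` on the unit square. If `C` is a copula,
then `C 1 1 = 1` and `C u 1 = u = C 1 u`, so that `U` and `V` are both uniform on `(0,1)`. -/
def FollowsCopula {Ω : Type*} [MeasurableSpace Ω] (μ : Measure Ω) (U V : Ω → ℝ)
    (C : ℝ → ℝ → ℝ) : Prop :=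
  ∀ u ∈ Set.Icc (0 : ℝ) 1, ∀ v ∈ Set.Icc (0 : ℝ) 1, μ.real {ω | U ω ≤ u ∧ V ω ≤ v} = C u v

/-- The `j`-th order statistic `f_{j:n}`, `1 ≤ j ≤ n`, of the sample `f`: its `j`-th smallest
value, counted with multiplicity. -/
noncomputable def orderStat {n : ℕ} (f : Fin n → ℝ) (j : ℕ) (hj : 1 ≤ j ∧ j ≤ n) : ℝ :=
  f (Tuple.sort f ⟨j - 1, by omega⟩)

/-- All the random variables `W₁ i`, `i < a`, and `W₂ i`, `i < b`, together are independent, each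
`W₁ i` has distribution function `u ↦ C(u,y) / y` and each `W₂ i` has distribution function
`u ↦ (u - C(u,y)) / (1 - y)` on `[0,1]`. -/
structure IsConditionalSample {Ω : Type*} [MeasurableSpace Ω] (ν : Measure Ω) (C : ℝ → ℝ → ℝ)
    (y : ℝ) {a b : ℕ} (W₁ : Fin a → Ω → ℝ) (W₂ : Fin b → Ω → ℝ) : Prop where
  measurable_fst : ∀ i, Measurable (W₁ i)
  measurable_snd : ∀ i, Measurable (W₂ i)
  indep : iIndepFun (Sum.elim W₁ W₂) ν
  cdf_fst : ∀ i, ∀ u ∈ Set.Icc (0 : ℝ) 1, ν.real {ω | W₁ i ω ≤ u} = C u y / y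
  cdf_snd : ∀ i, ∀ u ∈ Set.Icc (0 : ℝ) 1, ν.real {ω | W₂ i ω ≤ u} = (u - C u y) / (1 - y)

/-- The number of the values `W₁ i ω` and `W₂ i ω` that lie in `[0,x]`. -/
noncomputable def countIn {Ω : Type*} {a b : ℕ} (W₁ : Fin a → Ω → ℝ) (W₂ : Fin b → Ω → ℝ)
    (x : ℝ) (ω : Ω) : ℕ :=
  (∑ i, (Set.Icc 0 x).indicator (fun _ => 1) (W₁ i ω)) +
    ∑ i, (Set.Icc 0 x).indicator (fun _ => 1) (W₂ i ω)

/-! Almost surely the values `V i` have no ties, so the event that V_{k:n} lies in a Borel set B and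
U_{m:n} ≤ x splits according to the index i at which V_{k:n} is attained. Fix i and the value v of
`V i`. Of the other n-1 independent points, exactly k-1 must lie below v in the second coordinate,
and at least m-1 or at least m must have first coordinate ≤ x, according as point i itself does or
does not.

The quadrant probabilities at (x,v) factor as v·p, v·(1-p), (1-v)·q, (1-v)·(1-q) with p = C(x,v)/v
and q = (x-C(x,v))/(1-v). The count of the others is therefore a binomial weight times the law of S
(`ProbabilityTheory.iIndepFun.real_ncard_eq_and_ncard_eq`). Since C(x,·) is Lipschitz, `V i`
restricted to `U i` ≤ x has density d = ∂C/∂y, and restricted to `U i` > x it has density 1-d. The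
integrand thus contains d·P(S ≥ m-1) + (1-d)·P(S ≥ m) = P(S ≥ m) + d·P(S = m-1); this is
`pi_snd_mem_and_ncard_eq_and_le_ncard`.

Summing over i turns the binomial weight into the density of V_{k:n}, which is positive on (0,1).
Comparing integrals over all B and cancelling that density identifies the conditional distribution
for each fixed x (`ae_condDistrib_orderStat_real_Iic`). Joint measurability of the good set and
Fubini give the statement for almost every (x,y). -/

/-! ### Counts of independent events as coefficients of generating polynomials -/

section Counting

-- Expanding the product means choosing from each factor the `X` term (indices in `K`) or the
-- constant term; the degree is the size of `K`.
open Polynomial in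
theorem coeff_prod_linear {ι R : Type*} [Fintype ι] [DecidableEq ι] [CommRing R] (f g : ι → R)
    (l : ℕ) :
    (∏ i, (C (f i) * X + C (g i))).coeff l =
      ∑ K ∈ (Finset.univ : Finset (Finset ι)) with K.card = l,
        ∏ i, if i ∈ K then f i else g i := by
  rw [Fintype.prod_add, finsetSum_coeff, Finset.sum_filter]
  refine Finset.sum_congr rfl fun K _ => ?_
  rw [Finset.prod_mul_distrib, Finset.prod_const, ← map_prod, ← map_prod,
    mul_right_comm, ← C_mul, coeff_C_mul, coeff_X_pow, Finset.prod_ite]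
  have h1 : Finset.univ.filter (fun i => i ∈ K) = K := by ext; simp
  have h2 : Finset.univ.filter (fun i => i ∉ K) = Kᶜ := by ext; simp
  rw [h1, h2]
  by_cases h : K.card = l
  · simp [h]
  · simp [h, Ne.symm h]

theorem measurableSet_ncard_eq {ι Ω : Type*} [Fintype ι] [MeasurableSpace Ω]
    {A : ι → Set Ω} (hA : ∀ i, MeasurableSet (A i)) (l : ℕ) :
    MeasurableSet {ω | {i | ω ∈ A i}.ncard = l} := by
  classical
  have : {ω | {i | ω ∈ A i}.ncard = l} =
      ⋃ K ∈ (Finset.univ : Finset (Finset ι)).filter (fun K => K.card = l),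
        ⋂ i, {ω | ω ∈ A i ↔ i ∈ K} := by
    ext ω
    simp only [Set.mem_ofPred_eq, Finset.mem_filter, Finset.mem_univ, true_and, Set.mem_iUnion,
      Set.mem_iInter, exists_prop]
    constructor
    · intro h
      refine ⟨{i | ω ∈ A i}.toFinset, ?_, by simp⟩
      rw [← h, Set.ncard_eq_toFinset_card']
    · rintro ⟨K, hK, h⟩
      rw [← hK, ← Set.ncard_coe_finset]
      congr 1
      ext i; simp [h]
  rw [this]
  refine Finset.measurableSet_biUnion _ fun K _ => MeasurableSet.iInter fun i => ?_
  by_cases h : i ∈ K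
  · simpa [h] using hA i
  · simpa [h, ← Set.compl_def] using (hA i).compl

theorem measurableSet_le_ncard {ι Ω : Type*} [Fintype ι] [MeasurableSpace Ω]
    {A : ι → Set Ω} (hA : ∀ i, MeasurableSet (A i)) (l : ℕ) :
    MeasurableSet {ω | l ≤ {i | ω ∈ A i}.ncard} := by
  have : {ω | l ≤ {i | ω ∈ A i}.ncard} = ⋃ j ∈ Set.Ici l, {ω | {i | ω ∈ A i}.ncard = j} := by
    ext ω; simp
  rw [this]
  exact MeasurableSet.biUnion (Set.to_countable _) fun j _ => measurableSet_ncard_eq hA j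

open Polynomial in
/-- The joint probability that independent variables lie in prescribed sets and that a prescribed
number of them lie in further sets, as a coefficient of a product of linear polynomials. -/
theorem ProbabilityTheory.iIndepFun.real_forall_mem_and_ncard_eq {ι Ω β : Type*} [Fintype ι]
    [MeasurableSpace Ω] [MeasurableSpace β] {ν : Measure Ω} [IsProbabilityMeasure ν]
    {Y : ι → Ω → β} (hY : ∀ i, Measurable (Y i)) (hind : iIndepFun Y ν) {E A : ι → Set β}
    (hE : ∀ i, MeasurableSet (E i)) (hA : ∀ i, MeasurableSet (A i)) (l : ℕ) :
    ν.real {ω | (∀ i, Y i ω ∈ E i) ∧ {i | Y i ω ∈ A i}.ncard = l} =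
      (∏ i, (C (ν.real (Y i ⁻¹' (E i ∩ A i))) * X +
        C (ν.real (Y i ⁻¹' (E i \ A i))))).coeff l := by
  classical
  -- The event is partitioned by the exact set `K` of indices that hit `A`; each piece is an
  -- intersection of independent events.
  let T : Finset ι → ι → Set β := fun K i => if i ∈ K then E i ∩ A i else E i \ A i
  have hT : ∀ K i, MeasurableSet (T K i) := by
    intro K i
    by_cases h : i ∈ K
    · simpa [T, h] using (hE i).inter (hA i)
    · simpa [T, h] using (hE i).diff (hA i)
  have hset : {ω | (∀ i, Y i ω ∈ E i) ∧ {i | Y i ω ∈ A i}.ncard = l} =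
      ⋃ K ∈ (Finset.univ : Finset (Finset ι)).filter (fun K => K.card = l),
        ⋂ i, Y i ⁻¹' T K i := by
    ext ω
    simp only [Set.mem_ofPred_eq, Finset.mem_filter, Finset.mem_univ, true_and, Set.mem_iUnion,
      Set.mem_iInter, exists_prop, Set.mem_preimage]
    constructor
    · rintro ⟨h0, h⟩
      refine ⟨{i | Y i ω ∈ A i}.toFinset, ?_, fun i => ?_⟩
      · rw [← h, Set.ncard_eq_toFinset_card']
      · by_cases hi : Y i ω ∈ A i <;> simp [T, hi, h0 i]
    · rintro ⟨K, hK, h⟩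
      refine ⟨fun i => ?_, ?_⟩
      · have := h i
        by_cases hi : i ∈ K <;> simp [T, hi] at this <;> exact this.1
      · rw [← hK, ← Set.ncard_coe_finset]
        congr 1
        ext i
        have := h i
        by_cases hi : i ∈ K <;> simp [T, hi] at this <;> simp [hi, this.2]
  rw [hset, measureReal_biUnion_finset, coeff_prod_linear]
  · refine Finset.sum_congr rfl fun K _ => ?_
    have := hind.measure_inter_preimage_eq_mul Finset.univ (sets := T K) (fun i _ => hT K i)
    simp only [Finset.mem_univ, Set.iInter_true] at this
    rw [measureReal_def, this, ENNReal.toReal_prod]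
    refine Finset.prod_congr rfl fun i _ => ?_
    by_cases h : i ∈ K <;> simp [T, h, measureReal_def]
  · intro K _ L _ hKL
    refine Set.disjoint_left.2 fun ω hK hL => hKL ?_
    ext i
    have h1 := Set.mem_iInter.1 hK i
    have h2 := Set.mem_iInter.1 hL i
    by_cases hi : i ∈ K <;> by_cases hj : i ∈ L <;> simp [T, hi, hj] at h1 h2 ⊢ <;> tauto
  · exact fun K _ => MeasurableSet.iInter fun i => hY i (hT K i)

open Polynomial in
/-- The point probability at `l` of a sum of `a` Bernoulli variables with parameter `p` and `b`
Bernoulli variables with parameter `q`, all independent. -/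
noncomputable def twoGroupPMF (p q : ℝ) (a b l : ℕ) : ℝ :=
  ((C p * X + C (1 - p)) ^ a * (C q * X + C (1 - q)) ^ b).coeff l

/-- The probability that a sum of `a` Bernoulli variables with parameter `p` and `b`
Bernoulli variables with parameter `q`, all independent, is at least `m`. -/
noncomputable def twoGroupTail (p q : ℝ) (a b m : ℕ) : ℝ :=
  ∑ l ∈ Finset.Icc m (a + b), twoGroupPMF p q a b l

open Polynomial in
/-- The joint law of two counts of independent variables. -/
theorem ProbabilityTheory.iIndepFun.real_ncard_eq_and_ncard_eq {ι Ω β : Type*} [Fintype ι]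
    [MeasurableSpace Ω] [MeasurableSpace β] {ν : Measure Ω} [IsProbabilityMeasure ν]
    {Y : ι → Ω → β} (hY : ∀ i, Measurable (Y i)) (hind : iIndepFun Y ν) {D A : Set β}
    (hD : MeasurableSet D) (hA : MeasurableSet A) {v p q : ℝ}
    (h11 : ∀ i, ν.real (Y i ⁻¹' (D ∩ A)) = v * p)
    (h10 : ∀ i, ν.real (Y i ⁻¹' (D \ A)) = v * (1 - p))
    (h01 : ∀ i, ν.real (Y i ⁻¹' (Dᶜ ∩ A)) = (1 - v) * q)
    (h00 : ∀ i, ν.real (Y i ⁻¹' (Dᶜ \ A)) = (1 - v) * (1 - q)) (r l : ℕ) :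
    ν.real {ω | {i | Y i ω ∈ D}.ncard = r ∧ {i | Y i ω ∈ A}.ncard = l} =
      (Fintype.card ι).choose r * (v ^ r * (1 - v) ^ (Fintype.card ι - r)) *
        twoGroupPMF p q r (Fintype.card ι - r) l := by
  classical
  -- Partition by the exact set `J` of indices that hit `D`. All sets of size `r` contribute
  -- equally, whence the binomial coefficient.
  let E : Finset ι → ι → Set β := fun J i => if i ∈ J then D else Dᶜ
  have hE : ∀ J i, MeasurableSet (E J i) := by
    intro J i
    by_cases h : i ∈ J
    · simpa [E, h] using hD
    · simpa [E, h] using hD.compl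
  have hset : {ω | {i | Y i ω ∈ D}.ncard = r ∧ {i | Y i ω ∈ A}.ncard = l} =
      ⋃ J ∈ Finset.powersetCard r (Finset.univ : Finset ι),
        {ω | (∀ i, Y i ω ∈ E J i) ∧ {i | Y i ω ∈ A}.ncard = l} := by
    ext ω
    simp only [Set.mem_ofPred_eq, Finset.mem_powersetCard, Finset.subset_univ, true_and,
      Set.mem_iUnion, exists_prop]
    constructor
    · rintro ⟨h0, h⟩
      refine ⟨{i | Y i ω ∈ D}.toFinset, ?_, fun i => ?_, h⟩
      · rw [← h0, Set.ncard_eq_toFinset_card']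
      · by_cases hi : Y i ω ∈ D <;> simp [E, hi]
    · rintro ⟨K, hK, h, h'⟩
      refine ⟨?_, h'⟩
      rw [← hK, ← Set.ncard_coe_finset]
      congr 1
      ext i
      have := h i
      by_cases hi : i ∈ K <;> simp [E, hi] at this <;> simp [hi, this]
  rw [hset, measureReal_biUnion_finset]
  · have : ∀ J ∈ Finset.powersetCard r (Finset.univ : Finset ι),
        ν.real {ω | (∀ i, Y i ω ∈ E J i) ∧ {i | Y i ω ∈ A}.ncard = l} =
        (v ^ r * (1 - v) ^ (Fintype.card ι - r)) *
          twoGroupPMF p q r (Fintype.card ι - r) l := by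
      intro J hJ
      have hJ : J.card = r := (Finset.mem_powersetCard.1 hJ).2
      rw [hind.real_forall_mem_and_ncard_eq hY (hE J) (fun _ => hA)]
      have : ∀ i, (C (ν.real (Y i ⁻¹' (E J i ∩ A))) * X + C (ν.real (Y i ⁻¹' (E J i \ A)))) =
          if i ∈ J then C v * (C p * X + C (1 - p)) else
            C (1 - v) * (C q * X + C (1 - q)) := by
        intro i
        by_cases hi : i ∈ J
        · simp only [E, hi, if_true, h11, h10, C_mul]; ring
        · simp only [E, hi, if_false, h01, h00, C_mul]; ring
      simp_rw [this]
      rw [Finset.prod_ite, Finset.prod_const, Finset.prod_const]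
      have h1 : Finset.univ.filter (fun i => i ∈ J) = J := by ext; simp
      have h2 : Finset.univ.filter (fun i => i ∉ J) = Jᶜ := by ext; simp
      rw [h1, h2, Finset.card_compl, hJ, mul_pow, mul_pow, twoGroupPMF, ← coeff_C_mul, C_mul,
        C_pow, C_pow]
      congr 1
      ring
    rw [Finset.sum_congr rfl this, Finset.sum_const, Finset.card_powersetCard, Finset.card_univ,
      nsmul_eq_mul, ← mul_assoc]
  · intro K _ L _ hKL
    refine Set.disjoint_left.2 fun ω hK hL => hKL ?_
    ext i
    have h1 := hK.1 i
    have h2 := hL.1 i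
    by_cases hi : i ∈ K <;> by_cases hj : i ∈ L <;> simp [E, hi, hj] at h1 h2 ⊢ <;> tauto
  · intro K _
    have hK : MeasurableSet (⋂ i, Y i ⁻¹' E K i) := MeasurableSet.iInter fun i => hY i (hE K i)
    convert hK.inter (measurableSet_ncard_eq (A := fun i => Y i ⁻¹' A)
      (fun i => hY i hA) l) using 1
    ext ω; simp

theorem real_and_le_eq_sum {Ω : Type*} [MeasurableSpace Ω] {ν : Measure Ω}
    [IsFiniteMeasure ν] {P : Ω → Prop} {f : Ω → ℕ} {N : ℕ} (hf : ∀ ω, f ω ≤ N)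
    (hP : ∀ l, MeasurableSet {ω | P ω ∧ f ω = l}) (m : ℕ) :
    ν.real {ω | P ω ∧ m ≤ f ω} = ∑ l ∈ Finset.Icc m N, ν.real {ω | P ω ∧ f ω = l} := by
  have : {ω | P ω ∧ m ≤ f ω} = ⋃ l ∈ Finset.Icc m N, {ω | P ω ∧ f ω = l} := by
    ext ω
    simp only [Set.mem_ofPred_eq, Finset.mem_Icc, Set.mem_iUnion, exists_prop]
    exact ⟨fun h => ⟨f ω, ⟨h.2, hf ω⟩, h.1, rfl⟩, fun ⟨l, hl, h, h'⟩ => ⟨h, h' ▸ hl.1⟩⟩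
  rw [this, measureReal_biUnion_finset]
  · intro K _ L _ hKL
    exact Set.disjoint_left.2 fun ω hK hL => hKL (hK.2.symm.trans hL.2)
  · exact fun l _ => hP l

theorem ProbabilityTheory.iIndepFun.real_ncard_eq_and_le_ncard {ι Ω β : Type*} [Fintype ι]
    [MeasurableSpace Ω] [MeasurableSpace β] {ν : Measure Ω} [IsProbabilityMeasure ν]
    {Y : ι → Ω → β} (hY : ∀ i, Measurable (Y i)) (hind : iIndepFun Y ν) {D A : Set β}
    (hD : MeasurableSet D) (hA : MeasurableSet A) {v p q : ℝ}
    (h11 : ∀ i, ν.real (Y i ⁻¹' (D ∩ A)) = v * p)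
    (h10 : ∀ i, ν.real (Y i ⁻¹' (D \ A)) = v * (1 - p))
    (h01 : ∀ i, ν.real (Y i ⁻¹' (Dᶜ ∩ A)) = (1 - v) * q)
    (h00 : ∀ i, ν.real (Y i ⁻¹' (Dᶜ \ A)) = (1 - v) * (1 - q)) {r : ℕ}
    (hr : r ≤ Fintype.card ι) (m : ℕ) :
    ν.real {ω | {i | Y i ω ∈ D}.ncard = r ∧ m ≤ {i | Y i ω ∈ A}.ncard} =
      (Fintype.card ι).choose r * (v ^ r * (1 - v) ^ (Fintype.card ι - r)) *
        twoGroupTail p q r (Fintype.card ι - r) m := by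
  rw [real_and_le_eq_sum (N := Fintype.card ι), twoGroupTail, Finset.mul_sum]
  · rw [Nat.add_sub_cancel' hr]
    exact Finset.sum_congr rfl fun l _ =>
      hind.real_ncard_eq_and_ncard_eq hY hD hA h11 h10 h01 h00 r l
  · intro ω
    rw [← Nat.card_eq_fintype_card]
    exact Set.ncard_le_card _
  · exact fun l => (measurableSet_ncard_eq (A := fun i => Y i ⁻¹' D) (fun i => hY i hD) r).inter
      (measurableSet_ncard_eq (A := fun i => Y i ⁻¹' A) (fun i => hY i hA) l)

end Counting

/-! ### Copulas: Lipschitz bounds, densities and quadrant probabilities -/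

section Copula

open Set

/-- A measure whose distribution function is Lipschitz on the unit interval and varies only there
has the derivative of its distribution function as density. -/
theorem eq_withDensity_deriv_of_lipschitzOnWith {lam : Measure ℝ} [IsFiniteMeasure lam]
    {g : ℝ → ℝ} {K : NNReal} (hg : LipschitzOnWith K g (Icc 0 1)) (hmono : MonotoneOn g (Icc 0 1))
    (hg0 : g 0 = 0) (hlam : ∀ v ∈ Icc (0 : ℝ) 1, lam.real (Iic v) = g v)
    (huniv : lam.real univ = g 1) :
    lam = (volume.restrict (Ioo 0 1)).withDensity (fun v => ENNReal.ofReal (deriv g v)) := by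
  have hreal : ∀ v, lam (Iic v) = ENNReal.ofReal (lam.real (Iic v)) := fun v => by simp
  -- Lipschitz functions are absolutely continuous, so the fundamental theorem of calculus holds
  -- with the a.e. derivative.
  have key : ∀ v ∈ Icc (0 : ℝ) 1,
      ∫⁻ t in Ioc 0 v, ENNReal.ofReal (deriv g t) = ENNReal.ofReal (g v) := by
    intro v hv
    have hac : AbsolutelyContinuousOnInterval g 0 v := by
      apply LipschitzOnWith.absolutelyContinuousOnInterval (K := K)
      refine hg.mono ?_
      rw [uIcc_of_le hv.1]
      exact Icc_subset_Icc_right hv.2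
    have h := hac.integral_deriv_eq_sub
    have hi := hac.intervalIntegrable_deriv
    rw [intervalIntegral.integral_of_le hv.1, hg0, sub_zero] at h
    rw [intervalIntegrable_iff_integrableOn_Ioc_of_le hv.1] at hi
    rw [← h, ofReal_integral_eq_lintegral_ofReal hi]
    -- Monotonicity on `[0,1]` controls the two-sided derivative only at interior points, hence the
    -- open interval.
    have : ∀ᵐ t ∂(volume.restrict (Ioo 0 v)), 0 ≤ deriv g t := by
      refine ae_restrict_of_forall_mem measurableSet_Ioo fun t ht => ?_
      have := hmono.derivWithin_nonneg (x := t)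
      rwa [derivWithin_of_mem_nhds (Icc_mem_nhds ht.1 (ht.2.trans_le hv.2))] at this
    rwa [Measure.restrict_congr_set Ioo_ae_eq_Ioc] at this
  refine Measure.ext_of_Iic _ _ fun v => ?_
  rw [withDensity_apply _ measurableSet_Iic, Measure.restrict_restrict measurableSet_Iic, hreal]
  rcases lt_or_ge v 0 with hv | hv
  · have h1 : lam.real (Iic v) = 0 := by
      refine le_antisymm ?_ measureReal_nonneg
      rw [← hg0, ← hlam 0 (by simp)]
      exact measureReal_mono (Iic_subset_Iic.2 hv.le)
    have h2 : Iic v ∩ Ioo 0 1 = ∅ := by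
      ext t; simp only [mem_inter_iff, mem_Iic, mem_Ioo, mem_empty_iff_false, iff_false]
      intro h; linarith [h.1, h.2.1]
    simp [h1, h2]
  rcases le_or_gt v 1 with hv1 | hv1
  · have h2 : (Iic v ∩ Ioo 0 1 : Set ℝ) =ᵐ[volume] Ioc 0 v := by
      have := (ae_eq_refl (μ := volume) (Iic v)).inter (Ioo_ae_eq_Ioc (μ := volume) (a := (0:ℝ)) (b := 1))
      refine this.trans (Filter.EventuallyEq.of_eq ?_)
      ext t
      refine ⟨fun h => ⟨h.2.1, h.1⟩, fun h => ⟨h.2, h.1, h.2.trans hv1⟩⟩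
    rw [setLIntegral_congr h2, key v ⟨hv, hv1⟩, hlam v ⟨hv, hv1⟩]
  · have h1 : lam.real (Iic v) = g 1 := by
      refine le_antisymm ?_ ?_
      · rw [← huniv]; exact measureReal_mono (subset_univ _)
      · rw [← hlam 1 (by simp)]; exact measureReal_mono (Iic_subset_Iic.2 hv1.le)
    have h2 : (Iic v ∩ Ioo 0 1 : Set ℝ) = Ioo 0 1 :=
      inter_eq_self_of_subset_right fun t ht => (ht.2.trans hv1).le
    rw [h1, h2, setLIntegral_congr Ioo_ae_eq_Ioc, key 1 (by simp)]

variable {C : ℝ → ℝ → ℝ}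

namespace IsCopula

theorem mono_right (hC : IsCopula C) {u v₁ v₂ : ℝ} (hu : u ∈ Icc (0 : ℝ) 1)
    (h₁ : v₁ ∈ Icc (0 : ℝ) 1) (h₂ : v₂ ∈ Icc (0 : ℝ) 1) (h : v₁ ≤ v₂) : C u v₁ ≤ C u v₂ := by
  have := hC.two_increasing 0 (by simp) u hu v₁ h₁ v₂ h₂ hu.1 h
  rw [hC.zero_left _ h₁, hC.zero_left _ h₂] at this
  linarith

theorem sub_le_right (hC : IsCopula C) {u v₁ v₂ : ℝ} (hu : u ∈ Icc (0 : ℝ) 1)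
    (h₁ : v₁ ∈ Icc (0 : ℝ) 1) (h₂ : v₂ ∈ Icc (0 : ℝ) 1) (h : v₁ ≤ v₂) :
    C u v₂ - C u v₁ ≤ v₂ - v₁ := by
  have := hC.two_increasing u hu 1 (by simp) v₁ h₁ v₂ h₂ hu.2 h
  rw [hC.one_left _ h₁, hC.one_left _ h₂] at this
  linarith

theorem swap (hC : IsCopula C) : IsCopula (fun u v => C v u) where
  zero_left := hC.zero_right
  zero_right := hC.zero_left
  one_left := hC.one_right
  one_right := hC.one_left
  two_increasing u₁ hu₁ u₂ hu₂ v₁ hv₁ v₂ hv₂ hu hv := by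
    have := hC.two_increasing v₁ hv₁ v₂ hv₂ u₁ hu₁ u₂ hu₂ hv hu
    linarith

theorem lipschitzOnWith_right (hC : IsCopula C) {u : ℝ} (hu : u ∈ Icc (0 : ℝ) 1) :
    LipschitzOnWith 1 (C u) (Icc 0 1) := by
  refine LipschitzOnWith.of_dist_le_mul fun a ha b hb => ?_
  rw [Real.dist_eq, Real.dist_eq, NNReal.coe_one, one_mul]
  rcases le_total a b with h | h
  · rw [abs_sub_comm, abs_sub_comm a, abs_of_nonneg (sub_nonneg.2 h),
      abs_of_nonneg (sub_nonneg.2 (hC.mono_right hu ha hb h))]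
    exact hC.sub_le_right hu ha hb h
  · rw [abs_of_nonneg (sub_nonneg.2 h), abs_of_nonneg (sub_nonneg.2 (hC.mono_right hu hb ha h))]
    exact hC.sub_le_right hu hb ha h

theorem continuousOn_uncurry (hC : IsCopula C) :
    ContinuousOn (Function.uncurry C) (Icc 0 1 ×ˢ Icc 0 1) :=
  continuousOn_prod_of_continuousOn_lipschitzOnWith _ 1
    (fun _ hu => (hC.lipschitzOnWith_right hu).continuousOn)
    (fun _ hv => hC.swap.lipschitzOnWith_right hv)

theorem ae_differentiableAt_right (hC : IsCopula C) {u : ℝ} (hu : u ∈ Icc (0 : ℝ) 1) :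
    ∀ᵐ v ∂(volume.restrict (Ioo 0 1)), DifferentiableAt ℝ (C u) v := by
  have hac : AbsolutelyContinuousOnInterval (C u) 0 1 := by
    apply LipschitzOnWith.absolutelyContinuousOnInterval (K := 1)
    rw [uIcc_of_le zero_le_one]
    exact hC.lipschitzOnWith_right hu
  rw [ae_restrict_iff' measurableSet_Ioo]
  filter_upwards [hac.ae_differentiableAt] with v hv h
  exact hv (by rw [uIcc_of_le zero_le_one]; exact Ioo_subset_Icc_self h)

theorem deriv_nonneg (hC : IsCopula C) {u v : ℝ} (hu : u ∈ Icc (0 : ℝ) 1)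
    (hv : v ∈ Ioo (0 : ℝ) 1) : 0 ≤ deriv (C u) v := by
  have hm : MonotoneOn (C u) (Icc 0 1) := fun a ha b hb hab => hC.mono_right hu ha hb hab
  have := hm.derivWithin_nonneg (x := v)
  rwa [derivWithin_of_mem_nhds (Icc_mem_nhds hv.1 hv.2)] at this

theorem monotoneOn_sub (hC : IsCopula C) {u : ℝ} (hu : u ∈ Icc (0 : ℝ) 1) :
    MonotoneOn (fun v => v - C u v) (Icc 0 1) := fun a ha b hb hab => by
  have := hC.sub_le_right hu ha hb hab
  simp only
  linarith

end IsCopula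

namespace FollowsCopula

variable {Ω : Type*} [MeasurableSpace Ω] {μ : Measure Ω} {U V : Ω → ℝ}

theorem swap (h : FollowsCopula μ U V C) : FollowsCopula μ V U (fun u v => C v u) := by
  intro u hu v hv
  change _ = C v u
  rw [← h v hv u hu]
  congr 1
  ext ω
  simp [and_comm]

variable [IsProbabilityMeasure μ]

theorem ae_le_one (hC : IsCopula C) (h : FollowsCopula μ U V C) (hU : Measurable U)
    (hV : Measurable V) : ∀ᵐ ω ∂μ, U ω ≤ 1 ∧ V ω ≤ 1 := by
  have h1 := h 1 (by simp) 1 (by simp)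
  rw [hC.one_left 1 (by simp)] at h1
  have hm : MeasurableSet {ω | U ω ≤ 1 ∧ V ω ≤ 1} :=
    (measurableSet_le hU measurable_const).inter (measurableSet_le hV measurable_const)
  rw [measureReal_def, ENNReal.toReal_eq_one_iff] at h1
  exact (prob_compl_eq_zero_iff hm).2 h1

theorem real_fst_le (hC : IsCopula C) (h : FollowsCopula μ U V C) (hU : Measurable U)
    (hV : Measurable V) {u : ℝ} (hu : u ∈ Icc (0 : ℝ) 1) : μ.real {ω | U ω ≤ u} = u := by
  refine Eq.trans ?_ ((h u hu 1 (by simp)).trans (hC.one_right u hu))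
  refine measureReal_congr (Filter.eventuallyEq_set.2 ?_)
  filter_upwards [h.ae_le_one hC hU hV] with ω hω
  simp [hω.2]

theorem real_snd_le (hC : IsCopula C) (h : FollowsCopula μ U V C) (hU : Measurable U)
    (hV : Measurable V) {v : ℝ} (hv : v ∈ Icc (0 : ℝ) 1) : μ.real {ω | V ω ≤ v} = v :=
  h.swap.real_fst_le hC.swap hV hU hv

theorem real_snd_gt (hC : IsCopula C) (h : FollowsCopula μ U V C) (hU : Measurable U)
    (hV : Measurable V) {v : ℝ} (hv : v ∈ Icc (0 : ℝ) 1) : μ.real {ω | v < V ω} = 1 - v := by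
  have : {ω | v < V ω} = {ω | V ω ≤ v}ᶜ := by ext; simp
  rw [this, measureReal_compl (measurableSet_le hV measurable_const), h.real_snd_le hC hU hV hv]
  simp

theorem real_fst_le_inter_snd_gt (hC : IsCopula C) (h : FollowsCopula μ U V C) (hU : Measurable U)
    (hV : Measurable V) {u v : ℝ} (hu : u ∈ Icc (0 : ℝ) 1) (hv : v ∈ Icc (0 : ℝ) 1) :
    μ.real {ω | U ω ≤ u ∧ v < V ω} = u - C u v := by
  have h1 := measureReal_sdiff_add_inter (μ := μ) (s := {ω | U ω ≤ u}) (t := {ω | V ω ≤ v})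
    (measurableSet_le hV measurable_const)
  have h2 : {ω | U ω ≤ u ∧ v < V ω} = {ω | U ω ≤ u} \ {ω | V ω ≤ v} := by ext; simp
  have h3 : {ω | U ω ≤ u} ∩ {ω | V ω ≤ v} = {ω | U ω ≤ u ∧ V ω ≤ v} := by ext; simp
  rw [h3, h u hu v hv, h.real_fst_le hC hU hV hu] at h1
  rw [h2]
  linarith

theorem real_fst_gt_inter_snd_le (hC : IsCopula C) (h : FollowsCopula μ U V C) (hU : Measurable U)
    (hV : Measurable V) {u v : ℝ} (hu : u ∈ Icc (0 : ℝ) 1) (hv : v ∈ Icc (0 : ℝ) 1) :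
    μ.real {ω | u < U ω ∧ V ω ≤ v} = v - C u v := by
  rw [← h.swap.real_fst_le_inter_snd_gt hC.swap hV hU hv hu]
  congr 1
  ext; simp [and_comm]

theorem map_snd_restrict_fst_le (hC : IsCopula C) (h : FollowsCopula μ U V C) (hU : Measurable U)
    (hV : Measurable V) {x : ℝ} (hx : x ∈ Icc (0 : ℝ) 1) :
    (μ.restrict {ω | U ω ≤ x}).map V =
      (volume.restrict (Ioo 0 1)).withDensity (fun v => ENNReal.ofReal (deriv (C x) v)) := by
  refine eq_withDensity_deriv_of_lipschitzOnWith (hC.lipschitzOnWith_right hx)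
    (fun a ha b hb hab => hC.mono_right hx ha hb hab) (hC.zero_right x hx) (fun v hv => ?_) ?_
  · rw [map_measureReal_apply hV measurableSet_Iic,
      measureReal_restrict_apply (hV measurableSet_Iic), ← h x hx v hv]
    congr 1
    ext; simp [and_comm]
  · rw [map_measureReal_apply hV MeasurableSet.univ, preimage_univ,
      measureReal_restrict_apply MeasurableSet.univ, univ_inter, hC.one_right x hx,
      h.real_fst_le hC hU hV hx]

theorem map_snd_restrict_fst_gt (hC : IsCopula C) (h : FollowsCopula μ U V C) (hU : Measurable U)
    (hV : Measurable V) {x : ℝ} (hx : x ∈ Icc (0 : ℝ) 1) :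
    (μ.restrict {ω | x < U ω}).map V =
      (volume.restrict (Ioo 0 1)).withDensity (fun v => ENNReal.ofReal (1 - deriv (C x) v)) := by
  have hlip : LipschitzOnWith (1 + 1) (fun v => v - C x v) (Icc 0 1) :=
    LipschitzWith.id.lipschitzOnWith.sub (hC.lipschitzOnWith_right hx)
  rw [eq_withDensity_deriv_of_lipschitzOnWith (lam := (μ.restrict {ω | x < U ω}).map V) hlip (hC.monotoneOn_sub hx)
    (by rw [hC.zero_right x hx, sub_zero]) (fun v hv => ?_) ?_]
  -- The derivative of `v - C x v` is `1 - deriv (C x) v` only where `C x` is differentiable, which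
  -- is almost everywhere.
  · refine withDensity_congr_ae ?_
    filter_upwards [hC.ae_differentiableAt_right hx] with v hv
    rw [deriv_fun_sub differentiableAt_fun_id hv, deriv_id'']
  · rw [map_measureReal_apply hV MeasurableSet.univ, preimage_univ,
      measureReal_restrict_apply MeasurableSet.univ, univ_inter, hC.one_right x hx,
      h.swap.real_snd_gt hC.swap hV hU hx]
  · rw [map_measureReal_apply hV measurableSet_Iic,
      measureReal_restrict_apply (hV measurableSet_Iic),
      ← h.real_fst_gt_inter_snd_le hC hU hV hx hv]
    congr 1
    ext; simp [and_comm]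

theorem map_snd (hC : IsCopula C) (h : FollowsCopula μ U V C) (hU : Measurable U)
    (hV : Measurable V) : μ.map V = volume.restrict (Ioo 0 1) := by
  have : IsProbabilityMeasure (μ.map V) := Measure.isProbabilityMeasure_map hV.aemeasurable
  rw [eq_withDensity_deriv_of_lipschitzOnWith (lam := μ.map V) (g := fun v => v)
    LipschitzWith.id.lipschitzOnWith (fun a _ b _ hab => hab) rfl (fun v hv => ?_) (by simp)]
  · simp
  · rw [map_measureReal_apply hV measurableSet_Iic]
    exact h.real_snd_le hC hU hV hv

/-- The probabilities of the four quadrants at `(x, v)`. -/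
theorem real_quadrants (hC : IsCopula C) (h : FollowsCopula μ U V C) (hU : Measurable U)
    (hV : Measurable V) {x v : ℝ} (hx : x ∈ Icc (0 : ℝ) 1) (hv : v ∈ Icc (0 : ℝ) 1) :
    μ.real {ω | V ω < v ∧ U ω ≤ x} = C x v ∧ μ.real {ω | V ω < v ∧ x < U ω} = v - C x v ∧
      μ.real {ω | v ≤ V ω ∧ U ω ≤ x} = x - C x v ∧
      μ.real {ω | v ≤ V ω ∧ x < U ω} = 1 - x - v + C x v := by
  -- `V` has no atoms, so the strict inequalities used for ranks can replace the weak ones that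
  -- define `C`.
  have hne : ∀ᵐ ω ∂μ, V ω ≠ v := by
    have : μ.map V {v} = 0 := by rw [h.map_snd hC hU hV]; simp
    rw [Measure.map_apply hV (measurableSet_singleton v)] at this
    rw [ae_iff]
    convert this using 2
    ext; simp
  have e1 : μ.real {ω | V ω < v ∧ U ω ≤ x} = C x v := by
    rw [← h x hx v hv]
    refine measureReal_congr (Filter.eventuallyEq_set.2 ?_)
    filter_upwards [hne] with ω hω
    simp [and_comm, hω.le_iff_lt]
  have e2 : μ.real {ω | V ω < v ∧ x < U ω} = v - C x v := by
    rw [← h.real_fst_gt_inter_snd_le hC hU hV hx hv]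
    refine measureReal_congr (Filter.eventuallyEq_set.2 ?_)
    filter_upwards [hne] with ω hω
    simp [and_comm, hω.le_iff_lt]
  have e3 : μ.real {ω | v ≤ V ω ∧ U ω ≤ x} = x - C x v := by
    rw [← h.real_fst_le_inter_snd_gt hC hU hV hx hv]
    refine measureReal_congr (Filter.eventuallyEq_set.2 ?_)
    filter_upwards [hne] with ω hω
    simp [and_comm, hω.symm.le_iff_lt]
  refine ⟨e1, e2, e3, ?_⟩
  have h1 := measureReal_sdiff_add_inter (μ := μ) (s := {ω | v ≤ V ω}) (t := {ω | U ω ≤ x})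
    (measurableSet_le hU measurable_const)
  have h2 : {ω | v ≤ V ω ∧ x < U ω} = {ω | v ≤ V ω} \ {ω | U ω ≤ x} := by ext; simp
  have h3 : {ω | v ≤ V ω} ∩ {ω | U ω ≤ x} = {ω | v ≤ V ω ∧ U ω ≤ x} := by ext; simp
  have h4 : μ.real {ω | v ≤ V ω} = 1 - v := by
    rw [← h.real_snd_gt hC hU hV hv]
    refine measureReal_congr (Filter.eventuallyEq_set.2 ?_)
    filter_upwards [hne] with ω hω
    simp [hω.symm.le_iff_lt]
  rw [h3, e3, h4] at h1
  rw [h2]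
  linarith

end FollowsCopula

end Copula

/-! ### Order statistics through counting -/

section OrderStatistics

/-- After sorting, the positions with value at most `x` form an initial segment, and position `j -
1` (counted from 0) belongs to it exactly when its length is at least `j`. -/
theorem orderStat_le_iff {n : ℕ} (f : Fin n → ℝ) {j : ℕ} (hj : 1 ≤ j ∧ j ≤ n) (x : ℝ) :
    orderStat f j hj ≤ x ↔ j ≤ {i | f i ≤ x}.ncard := by
  have hmono := Tuple.monotone_sort f
  have h1 : {i | f i ≤ x}.ncard = {i | f (Tuple.sort f i) ≤ x}.ncard := by
    have : {i | f i ≤ x} = Tuple.sort f '' {i | f (Tuple.sort f i) ≤ x} := by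
      ext i
      simp only [Set.mem_ofPred_eq, Set.mem_image]
      exact ⟨fun h => ⟨(Tuple.sort f).symm i, by simpa using h, by simp⟩,
        fun ⟨l, hl, h⟩ => h ▸ hl⟩
    rw [this, Set.ncard_image_of_injective _ (Tuple.sort f).injective]
  have h2 := Tuple.lt_card_le_iff_apply_le_of_monotone (j := (⟨j - 1, by omega⟩ : Fin n))
    (f := f ∘ Tuple.sort f) (a := x) hmono
  have h3 : {i | f (Tuple.sort f i) ≤ x}.ncard =
      (Finset.univ.filter (fun i => (f ∘ Tuple.sort f) i ≤ x)).card := by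
    rw [← Set.ncard_coe_finset]; congr 1; ext; simp
  rw [h1, h3, orderStat]
  simp only [Function.comp_apply] at h2 ⊢
  rw [← h2]
  omega

theorem measurable_orderStat {n : ℕ} {Ω : Type*} [MeasurableSpace Ω] {f : Fin n → Ω → ℝ}
    (hf : ∀ i, Measurable (f i)) {j : ℕ} (hj : 1 ≤ j ∧ j ≤ n) :
    Measurable (fun ω => orderStat (fun i => f i ω) j hj) := by
  refine measurable_of_Iic fun x => ?_
  convert measurableSet_le_ncard (A := fun i => {ω | f i ω ≤ x})
    (fun i => measurableSet_le (hf i) measurable_const) j using 1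
  ext ω
  simp [orderStat_le_iff]

theorem exists_orderStat_eq {n : ℕ} (f : Fin n → ℝ) {j : ℕ} (hj : 1 ≤ j ∧ j ≤ n) :
    ∃ i, orderStat f j hj = f i := ⟨_, rfl⟩

/-- In a sample without ties, the `j`-th order statistic is the value with exactly `j - 1` smaller
values. -/
theorem orderStat_eq_iff {n : ℕ} {f : Fin n → ℝ} (hf : Function.Injective f) {j : ℕ}
    (hj : 1 ≤ j ∧ j ≤ n) (i : Fin n) :
    orderStat f j hj = f i ↔ {l | f l < f i}.ncard = j - 1 := by
  set σ := Tuple.sort f with hσ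
  have hmono : StrictMono (f ∘ σ) :=
    (Tuple.monotone_sort f).strictMono_of_injective (hf.comp σ.injective)
  -- Without ties the sorted sample is strictly increasing, so the number of smaller values is the
  -- sorted position of `i`.
  have h1 : {l | f l < f i} = σ '' (Set.Iio (σ.symm i)) := by
    ext l
    simp only [Set.mem_ofPred_eq, Set.mem_image, Set.mem_Iio]
    constructor
    · intro h
      refine ⟨σ.symm l, ?_, by simp⟩
      rw [← hmono.lt_iff_lt]
      simpa using h
    · rintro ⟨a, ha, rfl⟩
      have := hmono ha
      simpa using this
  rw [h1, Set.ncard_image_of_injective _ σ.injective, ← Finset.coe_Iio, Set.ncard_coe_finset,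
    Fin.card_Iio, orderStat, hf.eq_iff, ← Equiv.eq_symm_apply, Fin.ext_iff]
  exact eq_comm

/-- In a sample without ties, the event that the `j`-th order statistic lies in `B` is split
according to the index at which it is attained. -/
theorem orderStat_mem_iff {n : ℕ} {f : Fin n → ℝ} (hf : Function.Injective f) {j : ℕ}
    (hj : 1 ≤ j ∧ j ≤ n) (B : Set ℝ) :
    orderStat f j hj ∈ B ↔ ∃ i, f i ∈ B ∧ {l | f l < f i}.ncard = j - 1 := by
  constructor
  · intro h
    obtain ⟨i, hi⟩ := exists_orderStat_eq f hj
    exact ⟨i, hi ▸ h, (orderStat_eq_iff hf hj i).1 hi⟩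
  · rintro ⟨i, hi, h⟩
    rwa [(orderStat_eq_iff hf hj i).2 h]

/-- Together with the next lemma this expresses a count over the whole sample through the points
other than `i`. -/
theorem Set.ncard_setOf_succAbove {N : ℕ} (i : Fin (N + 1)) {P : Fin (N + 1) → Prop}
    (h : ¬ P i) : {l | P l}.ncard = {l | P (i.succAbove l)}.ncard := by
  have : {l | P l} = i.succAbove '' {l | P (i.succAbove l)} := by
    ext l
    simp only [Set.mem_ofPred_eq, Set.mem_image]
    constructor
    · intro hl
      obtain ⟨a, rfl⟩ := Fin.exists_succAbove_eq (x := l) (y := i) (fun e => h (e ▸ hl))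
      exact ⟨a, hl, rfl⟩
    · rintro ⟨a, ha, rfl⟩
      exact ha
  rw [this, Set.ncard_image_of_injective _ Fin.succAbove_right_injective]

theorem Set.ncard_setOf_succAbove_add_one {N : ℕ} (i : Fin (N + 1)) {P : Fin (N + 1) → Prop}
    (h : P i) : {l | P l}.ncard = {l | P (i.succAbove l)}.ncard + 1 := by
  have : {l | P l} = insert i {l | P l ∧ l ≠ i} := by
    ext l
    simp only [Set.mem_ofPred_eq, Set.mem_insert_iff]
    by_cases hl : l = i <;> simp [hl, h]
  rw [this, Set.ncard_insert_of_notMem (by simp),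
    Set.ncard_setOf_succAbove i (P := fun l => P l ∧ l ≠ i) (by simp)]
  congr 2
  ext l
  simp [Fin.succAbove_ne]

end OrderStatistics

/-! ### The joint law of V_{k:n} and the event U_{m:n} ≤ x -/

section JointLaw

open Set

/-- The candidate for the conditional distribution function of `U_{m:n}` given `V_{k:n} = y`, with
`a = k - 1` and `b = n - k`. -/
noncomputable def orderStatCondCDF (C : ℝ → ℝ → ℝ) (a b m : ℕ) (x y : ℝ) : ℝ :=
  twoGroupTail (C x y / y) ((x - C x y) / (1 - y)) a b m +
    deriv (C x) y * twoGroupPMF (C x y / y) ((x - C x y) / (1 - y)) a b (m - 1)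

/-- The upper bound on `m` keeps `m - 1` inside the range of summation. This identity merges the
cases `U i ≤ x` and `U i > x` into the stated formula. -/
theorem twoGroupTail_pred (p q : ℝ) {a b m : ℕ} (hm : 1 ≤ m) (hm' : m ≤ a + b + 1) :
    twoGroupTail p q a b (m - 1) = twoGroupPMF p q a b (m - 1) + twoGroupTail p q a b m := by
  obtain ⟨m, rfl⟩ : ∃ l, m = l + 1 := ⟨m - 1, by omega⟩
  rw [Nat.add_sub_cancel, twoGroupTail, twoGroupTail,
    ← Finset.insert_Icc_add_one_left_eq_Icc (by omega : m ≤ a + b), Finset.sum_insert (by simp)]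

variable {C : ℝ → ℝ → ℝ}

/-- Holds at every interior point, since `deriv` takes the value 0 where the derivative does not
exist. -/
theorem IsCopula.deriv_le_one (hC : IsCopula C) {u v : ℝ} (hu : u ∈ Icc (0 : ℝ) 1)
    (hv : v ∈ Ioo (0 : ℝ) 1) : deriv (C u) v ≤ 1 := by
  by_cases hd : DifferentiableAt ℝ (C u) v
  · have := (hC.monotoneOn_sub hu).derivWithin_nonneg (x := v)
    rw [derivWithin_of_mem_nhds (Icc_mem_nhds hv.1 hv.2),
      deriv_fun_sub differentiableAt_fun_id hd, deriv_id''] at this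
    linarith
  · rw [deriv_zero_of_not_differentiableAt hd]
    exact zero_le_one

theorem pi_real_ncard_eq_and_le_ncard (hC : IsCopula C) {N : ℕ} {ρ : Fin N → Measure (ℝ × ℝ)}
    [∀ i, IsProbabilityMeasure (ρ i)] (hρ : ∀ i, FollowsCopula (ρ i) Prod.fst Prod.snd C)
    {x v : ℝ} (hx : x ∈ Icc (0 : ℝ) 1) (hv : v ∈ Ioo (0 : ℝ) 1) {r : ℕ} (hr : r ≤ N) (m : ℕ) :
    (Measure.pi ρ).real {w | {l | (w l).2 < v}.ncard = r ∧ m ≤ {l | (w l).1 ≤ x}.ncard} =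
      N.choose r * (v ^ r * (1 - v) ^ (N - r)) *
        twoGroupTail (C x v / v) ((x - C x v) / (1 - v)) r (N - r) m := by
  have hind : iIndepFun (fun (i : Fin N) (w : Fin N → ℝ × ℝ) => w i) (Measure.pi ρ) :=
    iIndepFun_pi (X := fun _ => id) (fun _ => aemeasurable_id)
  have hv0 : v ≠ 0 := hv.1.ne'
  have hv1 : 1 - v ≠ 0 := (sub_pos.2 hv.2).ne'
  have hq := fun i => (hρ i).real_quadrants hC measurable_fst measurable_snd hx
    (Ioo_subset_Icc_self hv)
  have hD : MeasurableSet {z : ℝ × ℝ | z.2 < v} := measurableSet_lt measurable_snd measurable_const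
  have hA : MeasurableSet {z : ℝ × ℝ | z.1 ≤ x} := measurableSet_le measurable_fst measurable_const
  have heval : ∀ i {S : Set (ℝ × ℝ)}, MeasurableSet S →
      (Measure.pi ρ).real ((fun w : Fin N → ℝ × ℝ => w i) ⁻¹' S) = (ρ i).real S := fun i S hS =>
    (measurePreserving_eval ρ i).measureReal_preimage hS.nullMeasurableSet
  have := hind.real_ncard_eq_and_le_ncard (fun i => measurable_pi_apply i) hD hA (v := v)
    (p := C x v / v) (q := (x - C x v) / (1 - v)) ?_ ?_ ?_ ?_ (r := r)
    (by rwa [Fintype.card_fin]) m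
  · rw [Fintype.card_fin] at this
    exact this
  · intro i
    rw [heval i (hD.inter hA), mul_div_cancel₀ _ hv0, ← (hq i).1]
    rfl
  · intro i
    rw [heval i (hD.diff hA), mul_sub, mul_div_cancel₀ _ hv0, mul_one, ← (hq i).2.1]
    congr 1; ext; simp
  · intro i
    rw [heval i (hD.compl.inter hA), mul_div_cancel₀ _ hv1, ← (hq i).2.2.1]
    congr 1; ext; simp
  · intro i
    rw [heval i (hD.compl.diff hA), mul_sub, mul_div_cancel₀ _ hv1, mul_one]
    trans 1 - x - v + C x v
    · rw [← (hq i).2.2.2]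
      congr 1; ext; simp
    · ring

theorem measurableSet_ncard_snd_lt_and_le_ncard_fst (N r m : ℕ) (x : ℝ) :
    MeasurableSet {p : ℝ × (Fin N → ℝ × ℝ) | {l | (p.2 l).2 < p.1}.ncard = r ∧
      m ≤ {l | (p.2 l).1 ≤ x}.ncard} := by
  refine (measurableSet_ncard_eq (A := fun l => {p : ℝ × (Fin N → ℝ × ℝ) | (p.2 l).2 < p.1})
    (fun l => ?_) r).inter (measurableSet_le_ncard
      (A := fun l => {p : ℝ × (Fin N → ℝ × ℝ) | (p.2 l).1 ≤ x}) (fun l => ?_) m)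
  · exact measurableSet_lt (by fun_prop) (by fun_prop)
  · exact measurableSet_le (by fun_prop) (by fun_prop)

/-- The contribution of the index `i` to the joint law of `V_{k:n}` and `U_{m:n}`. -/
theorem pi_snd_mem_and_ncard_eq_and_le_ncard (hC : IsCopula C) {N : ℕ}
    {ρ : Fin (N + 1) → Measure (ℝ × ℝ)} [∀ i, IsProbabilityMeasure (ρ i)]
    (hρ : ∀ i, FollowsCopula (ρ i) Prod.fst Prod.snd C) {x : ℝ} (hx : x ∈ Icc (0 : ℝ) 1)
    {r : ℕ} (hr : r ≤ N) {m : ℕ} (hm : 1 ≤ m) (hm' : m ≤ N + 1) {B : Set ℝ}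
    (hB : MeasurableSet B) (i : Fin (N + 1)) :
    Measure.pi ρ {z | (z i).2 ∈ B ∧ {l | (z l).2 < (z i).2}.ncard = r ∧
        m ≤ {l | (z l).1 ≤ x}.ncard} =
      ∫⁻ v in Ioo 0 1, B.indicator (fun v => ENNReal.ofReal
        (N.choose r * (v ^ r * (1 - v) ^ (N - r)) * orderStatCondCDF C r (N - r) m x v)) v := by
  set ν : Measure (Fin N → ℝ × ℝ) := Measure.pi (fun l => ρ (i.succAbove l)) with hν
  let R : ℕ → Set (ℝ × (Fin N → ℝ × ℝ)) := fun j =>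
    {p | {l | (p.2 l).2 < p.1}.ncard = r ∧ j ≤ {l | (p.2 l).1 ≤ x}.ncard}
  have hR : ∀ j, MeasurableSet (R j) := fun j => measurableSet_ncard_snd_lt_and_le_ncard_fst N r j x
  let Q : ℕ → ℝ → ENNReal := fun j v => ν (Prod.mk v ⁻¹' R j)
  have hQ : ∀ j, Measurable (Q j) := fun j => measurable_measure_prodMk_left (hR j)
  have hQB : ∀ j, Measurable (B.indicator (Q j)) := fun j => (hQ j).indicator hB
  have hlow : MeasurableSet {z : ℝ × ℝ | z.1 ≤ x} :=
    measurableSet_le measurable_fst measurable_const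
  -- The event in terms of point `i` and the remaining `N` points: these must supply `m - 1` first
  -- coordinates below `x` if point `i` supplies one, and `m` otherwise.
  let T : Set ((ℝ × ℝ) × (Fin N → ℝ × ℝ)) :=
    {p | p.1.2 ∈ B ∧ ((p.1.1 ≤ x ∧ (p.1.2, p.2) ∈ R (m - 1)) ∨
      (x < p.1.1 ∧ (p.1.2, p.2) ∈ R m))}
  have hT : MeasurableSet T := by
    have hpair : Measurable fun p : (ℝ × ℝ) × (Fin N → ℝ × ℝ) => (p.1.2, p.2) := by fun_prop
    refine MeasurableSet.inter ((by fun_prop : Measurable fun p : (ℝ × ℝ) × (Fin N → ℝ × ℝ) =>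
      p.1.2) hB) (MeasurableSet.union ?_ ?_)
    · exact (measurableSet_le measurable_fst.fst measurable_const).inter (hpair (hR _))
    · exact (measurableSet_lt measurable_const measurable_fst.fst).inter (hpair (hR _))
  have hpre : {z : Fin (N + 1) → ℝ × ℝ | (z i).2 ∈ B ∧ {l | (z l).2 < (z i).2}.ncard = r ∧
      m ≤ {l | (z l).1 ≤ x}.ncard} =
      (MeasurableEquiv.piFinSuccAbove (fun _ => ℝ × ℝ) i) ⁻¹' T := by
    ext z
    simp only [mem_ofPred_eq, mem_preimage, MeasurableEquiv.piFinSuccAbove_apply, T, R,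
      Fin.insertNthEquiv_symm_apply, Fin.removeNth_apply]
    -- The strict inequality keeps point `i` out of its own rank count.
    rw [Set.ncard_setOf_succAbove i (P := fun l => (z l).2 < (z i).2) (lt_irrefl _)]
    rcases le_or_gt (z i).1 x with h | h
    · rw [Set.ncard_setOf_succAbove_add_one i (P := fun l => (z l).1 ≤ x) h,
        ← Nat.sub_le_iff_le_add]
      simp [h, h.not_gt]
    · rw [Set.ncard_setOf_succAbove i (P := fun l => (z l).1 ≤ x) h.not_ge]
      simp [h, h.not_ge]
  have hsec1 : ∀ z ∈ {z : ℝ × ℝ | z.1 ≤ x}, ν (Prod.mk z ⁻¹' T) = B.indicator (Q (m - 1)) z.2 := by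
    intro z hz
    have hz : z.1 ≤ x := hz
    by_cases hzB : z.2 ∈ B
    · rw [indicator_of_mem hzB]
      congr 1; ext w; simp [T, hz, hzB, hz.not_gt]
    · rw [indicator_of_notMem hzB]
      convert measure_empty (μ := ν); ext w; simp [T, hzB]
  have hsec2 : ∀ z ∈ {z : ℝ × ℝ | z.1 ≤ x}ᶜ, ν (Prod.mk z ⁻¹' T) = B.indicator (Q m) z.2 := by
    intro z hz
    have hz : x < z.1 := not_le.1 hz
    by_cases hzB : z.2 ∈ B
    · rw [indicator_of_mem hzB]
      congr 1; ext w; simp [T, hz, hzB, hz.not_ge]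
    · rw [indicator_of_notMem hzB]
      convert measure_empty (μ := ν); ext w; simp [T, hzB]
  have hcompl : {z : ℝ × ℝ | z.1 ≤ x}ᶜ = {z : ℝ × ℝ | x < z.1} := by ext; simp
  -- Fubini over point `i`, split at first coordinate `x`. On each half the inner measure depends
  -- only on the second coordinate, whose restricted law has density `deriv (C x)` or `1 - deriv (C
  -- x)`.
  rw [hpre, (measurePreserving_piFinSuccAbove ρ i).measure_preimage hT.nullMeasurableSet,
    Measure.prod_apply hT, ← lintegral_add_compl _ hlow, setLIntegral_congr_fun hlow hsec1,
    setLIntegral_congr_fun hlow.compl hsec2, ← lintegral_map (hQB _) measurable_snd,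
    ← lintegral_map (hQB _) measurable_snd, hcompl,
    (hρ i).map_snd_restrict_fst_le hC measurable_fst measurable_snd hx,
    (hρ i).map_snd_restrict_fst_gt hC measurable_fst measurable_snd hx,
    lintegral_withDensity_eq_lintegral_mul _ (measurable_deriv _).ennreal_ofReal (hQB _),
    lintegral_withDensity_eq_lintegral_mul _
      (f := fun v => ENNReal.ofReal (1 - deriv (C x) v))
      (measurable_const.sub (measurable_deriv _)).ennreal_ofReal (hQB _),
    ← lintegral_add_left ((measurable_deriv _).ennreal_ofReal.mul (hQB _))]
  refine setLIntegral_congr_fun measurableSet_Ioo fun v hv => ?_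
  simp only [Pi.mul_apply]
  by_cases hvB : v ∈ B
  · have hQv : ∀ j, Q j v = ENNReal.ofReal (N.choose r * (v ^ r * (1 - v) ^ (N - r)) *
        twoGroupTail (C x v / v) ((x - C x v) / (1 - v)) r (N - r) j) := by
      intro j
      rw [← pi_real_ncard_eq_and_le_ncard hC (fun l => hρ (i.succAbove l)) hx hv hr j,
        ofReal_measureReal]
      rfl
    have hd0 := hC.deriv_nonneg hx hv
    have hd1 := sub_nonneg.2 (hC.deriv_le_one hx hv)
    have hQ0 : ∀ j, 0 ≤ N.choose r * (v ^ r * (1 - v) ^ (N - r)) *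
        twoGroupTail (C x v / v) ((x - C x v) / (1 - v)) r (N - r) j := by
      intro j
      rw [← pi_real_ncard_eq_and_le_ncard hC (fun l => hρ (i.succAbove l)) hx hv hr j]
      exact measureReal_nonneg
    simp only [indicator_of_mem hvB]
    rw [hQv, hQv, ← ENNReal.ofReal_mul hd0, ← ENNReal.ofReal_mul hd1,
      ← ENNReal.ofReal_add (mul_nonneg hd0 (hQ0 _)) (mul_nonneg hd1 (hQ0 _)),
      twoGroupTail_pred _ _ hm (by omega), orderStatCondCDF]
    congr 1
    ring
  · simp [hvB]

/-- The second marginals have no atoms, so by Fubini each coincidence of two of them is a null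
event. -/
theorem ae_injective_snd (hC : IsCopula C) {N : ℕ}
    {ρ : Fin (N + 1) → Measure (ℝ × ℝ)} [∀ i, IsProbabilityMeasure (ρ i)]
    (hρ : ∀ i, FollowsCopula (ρ i) Prod.fst Prod.snd C) :
    ∀ᵐ z ∂(Measure.pi ρ), Function.Injective (fun i => (z i).2) := by
  have key : ∀ (i : Fin (N + 1)) (l : Fin N),
      ∀ᵐ z ∂(Measure.pi ρ), (z i).2 ≠ (z (i.succAbove l)).2 := by
    intro i l
    let T : Set ((ℝ × ℝ) × (Fin N → ℝ × ℝ)) := {p | p.1.2 = (p.2 l).2}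
    have hT : MeasurableSet T := measurableSet_eq_fun (by fun_prop) (by fun_prop)
    have hpre : {z : Fin (N + 1) → ℝ × ℝ | (z i).2 = (z (i.succAbove l)).2} =
      (MeasurableEquiv.piFinSuccAbove (fun _ => ℝ × ℝ) i) ⁻¹' T := rfl
    rw [ae_iff]
    simp only [ne_eq, not_not]
    rw [hpre, (measurePreserving_piFinSuccAbove ρ i).measure_preimage hT.nullMeasurableSet,
      Measure.measure_prod_null hT]
    refine Filter.Eventually.of_forall fun z => ?_
    have hm : MeasurableSet {y : ℝ × ℝ | z.2 = y.2} :=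
      measurableSet_eq_fun measurable_const measurable_snd
    have h1 : (ρ (i.succAbove l)) {y : ℝ × ℝ | z.2 = y.2} = 0 := by
      have h2 : (ρ (i.succAbove l)).map Prod.snd {z.2} = 0 := by
        rw [(hρ _).map_snd hC measurable_fst measurable_snd]; simp
      rw [Measure.map_apply measurable_snd (measurableSet_singleton _)] at h2
      convert h2 using 2
      ext; simp [eq_comm]
    exact ((measurePreserving_eval (fun l => ρ (i.succAbove l)) l).measure_preimage
      hm.nullMeasurableSet).trans h1
  have key' : ∀ᵐ z ∂(Measure.pi ρ), ∀ i l, (z i).2 ≠ (z (i.succAbove l)).2 :=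
    ae_all_iff.2 fun i => ae_all_iff.2 fun l => key i l
  filter_upwards [key'] with z hz i j hij
  by_contra hne
  obtain ⟨l, rfl⟩ := Fin.exists_succAbove_eq (x := j) (y := i) (Ne.symm hne)
  exact hz i l hij

/-- The pieces indexed by the point attaining the order statistic are disjoint up to null sets and
contribute equally, which gives the factor `N + 1`. -/
theorem pi_orderStat_mem_and_orderStat_le (hC : IsCopula C) {N : ℕ}
    {ρ : Fin (N + 1) → Measure (ℝ × ℝ)} [∀ i, IsProbabilityMeasure (ρ i)]
    (hρ : ∀ i, FollowsCopula (ρ i) Prod.fst Prod.snd C) {x : ℝ} (hx : x ∈ Icc (0 : ℝ) 1)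
    {k m : ℕ} (hk : 1 ≤ k ∧ k ≤ N + 1) (hm : 1 ≤ m ∧ m ≤ N + 1) {B : Set ℝ}
    (hB : MeasurableSet B) :
    Measure.pi ρ {z | orderStat (fun i => (z i).2) k hk ∈ B ∧
        orderStat (fun i => (z i).1) m hm ≤ x} =
      (N + 1 : ℕ) * ∫⁻ v in Ioo 0 1, B.indicator (fun v => ENNReal.ofReal
        (N.choose (k - 1) * (v ^ (k - 1) * (1 - v) ^ (N - (k - 1))) *
          orderStatCondCDF C (k - 1) (N - (k - 1)) m x v)) v := by
  let S : Fin (N + 1) → Set (Fin (N + 1) → ℝ × ℝ) := fun i =>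
    {z | (z i).2 ∈ B ∧ {l | (z l).2 < (z i).2}.ncard = k - 1 ∧ m ≤ {l | (z l).1 ≤ x}.ncard}
  have hS : ∀ i, MeasurableSet (S i) := by
    intro i
    refine MeasurableSet.inter ((by fun_prop : Measurable fun z : Fin (N + 1) → ℝ × ℝ =>
      (z i).2) hB) (MeasurableSet.inter ?_ ?_)
    · exact measurableSet_ncard_eq (A := fun l => {z : Fin (N + 1) → ℝ × ℝ | (z l).2 < (z i).2})
        (fun l => measurableSet_lt (by fun_prop) (by fun_prop)) _
    · exact measurableSet_le_ncard (A := fun l => {z : Fin (N + 1) → ℝ × ℝ | (z l).1 ≤ x})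
        (fun l => measurableSet_le (by fun_prop) (by fun_prop)) _
  have hae : {z : Fin (N + 1) → ℝ × ℝ | orderStat (fun i => (z i).2) k hk ∈ B ∧
      orderStat (fun i => (z i).1) m hm ≤ x} =ᵐ[Measure.pi ρ] ⋃ i, S i := by
    refine Filter.eventuallyEq_set.2 ?_
    filter_upwards [ae_injective_snd hC hρ] with z hz
    simp only [mem_ofPred_eq, mem_iUnion, S, orderStat_mem_iff hz, orderStat_le_iff]
    exact ⟨fun ⟨⟨i, h1, h2⟩, h3⟩ => ⟨i, h1, h2, h3⟩, fun ⟨i, h1, h2, h3⟩ => ⟨⟨i, h1, h2⟩, h3⟩⟩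
  have hdisj : Pairwise (Function.onFun (AEDisjoint (Measure.pi ρ)) S) := by
    intro i j hij
    have : ∀ᵐ z ∂(Measure.pi ρ), z ∉ S i ∩ S j := by
      filter_upwards [ae_injective_snd hC hρ] with z hz hzS
      have h1 := (orderStat_eq_iff hz hk i).2 hzS.1.2.1
      have h2 := (orderStat_eq_iff hz hk j).2 hzS.2.2.1
      exact hij (hz (h1.symm.trans h2))
    rw [ae_iff] at this
    simp only [not_not] at this
    exact this
  rw [measure_congr hae, measure_iUnion₀ hdisj fun i => (hS i).nullMeasurableSet, tsum_fintype,
    Finset.sum_congr rfl fun i _ => pi_snd_mem_and_ncard_eq_and_le_ncard hC hρ hx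
      (by omega : k - 1 ≤ N) hm.1 hm.2 hB i]
  simp

/-- The joint law of an order statistic of the second coordinates and of the event that an order
statistic of the first coordinates is at most `x`. -/
theorem measure_orderStat_mem_and_orderStat_le {Ω : Type*} [MeasurableSpace Ω] {μ : Measure Ω}
    [IsProbabilityMeasure μ] (hC : IsCopula C) {N : ℕ} {U V : Fin (N + 1) → Ω → ℝ}
    (hU : ∀ i, Measurable (U i)) (hV : ∀ i, Measurable (V i))
    (hindep : iIndepFun (fun i ω => (U i ω, V i ω)) μ)
    (hlaw : ∀ i, FollowsCopula μ (U i) (V i) C) {x : ℝ} (hx : x ∈ Icc (0 : ℝ) 1)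
    {k m : ℕ} (hk : 1 ≤ k ∧ k ≤ N + 1) (hm : 1 ≤ m ∧ m ≤ N + 1) {B : Set ℝ}
    (hB : MeasurableSet B) :
    μ {ω | orderStat (fun i => V i ω) k hk ∈ B ∧ orderStat (fun i => U i ω) m hm ≤ x} =
      (N + 1 : ℕ) * ∫⁻ v in Ioo 0 1, B.indicator (fun v => ENNReal.ofReal
        (N.choose (k - 1) * (v ^ (k - 1) * (1 - v) ^ (N - (k - 1))) *
          orderStatCondCDF C (k - 1) (N - (k - 1)) m x v)) v := by
  have hUV : ∀ i, Measurable fun ω => (U i ω, V i ω) := fun i => (hU i).prodMk (hV i)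
  have : ∀ i, IsProbabilityMeasure (μ.map fun ω => (U i ω, V i ω)) := fun i =>
    Measure.isProbabilityMeasure_map (hUV i).aemeasurable
  -- Independence makes the law of the whole sample a product measure, where the previous
  -- computation applies.
  have hmap := (iIndepFun_iff_map_fun_eq_pi_map fun i => (hUV i).aemeasurable).1 hindep
  have hρ : ∀ i, FollowsCopula (μ.map fun ω => (U i ω, V i ω)) Prod.fst Prod.snd C := by
    intro i u hu v hv
    have hm : MeasurableSet {z : ℝ × ℝ | z.1 ≤ u ∧ z.2 ≤ v} :=
      (measurableSet_le measurable_fst measurable_const).inter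
        (measurableSet_le measurable_snd measurable_const)
    rw [map_measureReal_apply (hUV i) hm, ← hlaw i u hu v hv]
    rfl
  rw [← pi_orderStat_mem_and_orderStat_le hC hρ hx hk hm hB, ← hmap,
    Measure.map_apply (measurable_pi_lambda _ hUV)]
  · rfl
  · exact (measurable_orderStat (fun i => (measurable_pi_apply i).snd) hk hB).inter
      (measurableSet_le (measurable_orderStat (fun i => (measurable_pi_apply i).fst) hm)
        measurable_const)

end JointLaw

/-! ### The law of the auxiliary count S -/

section BernoulliSums

open Set

open Polynomial in
theorem twoGroupPMF_eq_coeff_prod (p q : ℝ) (a b l : ℕ) :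
    twoGroupPMF p q a b l = (∏ i : Fin a ⊕ Fin b,
      (C (Sum.elim (fun _ => p) (fun _ => q) i) * X +
        C (1 - Sum.elim (fun _ => p) (fun _ => q) i))).coeff l := by
  rw [twoGroupPMF, Fintype.prod_sum_type]
  simp

/-- This explicit form makes nonnegativity and measurable dependence on `p` and `q` visible. -/
theorem twoGroupPMF_eq_sum (p q : ℝ) (a b l : ℕ) :
    twoGroupPMF p q a b l =
      ∑ K ∈ (Finset.univ : Finset (Finset (Fin a ⊕ Fin b))) with K.card = l,
        ∏ i, if i ∈ K then Sum.elim (fun _ => p) (fun _ => q) i else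
          1 - Sum.elim (fun _ => p) (fun _ => q) i := by
  rw [twoGroupPMF_eq_coeff_prod,
    coeff_prod_linear _ (fun i => 1 - Sum.elim (fun _ => p) (fun _ => q) i)]

theorem twoGroupPMF_nonneg {p q : ℝ} (hp : p ∈ Icc (0 : ℝ) 1) (hq : q ∈ Icc (0 : ℝ) 1)
    (a b l : ℕ) : 0 ≤ twoGroupPMF p q a b l := by
  rw [twoGroupPMF_eq_sum]
  refine Finset.sum_nonneg fun K _ => Finset.prod_nonneg fun i _ => ?_
  have := hp.1; have := hp.2; have := hq.1; have := hq.2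
  rcases i with i | i <;> split_ifs <;> simp_all

theorem twoGroupTail_nonneg {p q : ℝ} (hp : p ∈ Icc (0 : ℝ) 1) (hq : q ∈ Icc (0 : ℝ) 1)
    (a b m : ℕ) : 0 ≤ twoGroupTail p q a b m :=
  Finset.sum_nonneg fun _ _ => twoGroupPMF_nonneg hp hq _ _ _

theorem measurable_twoGroupPMF {α : Type*} [MeasurableSpace α] {f g : α → ℝ} (hf : Measurable f)
    (hg : Measurable g) (a b l : ℕ) : Measurable fun t => twoGroupPMF (f t) (g t) a b l := by
  simp_rw [twoGroupPMF_eq_sum]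
  refine Finset.measurable_fun_sum _ fun K _ => Finset.measurable_fun_prod _ fun i _ => ?_
  rcases i with i | i <;> split_ifs <;> simp only [Sum.elim_inl, Sum.elim_inr] <;> fun_prop

theorem measurable_twoGroupTail {α : Type*} [MeasurableSpace α] {f g : α → ℝ} (hf : Measurable f)
    (hg : Measurable g) (a b m : ℕ) : Measurable fun t => twoGroupTail (f t) (g t) a b m :=
  Finset.measurable_fun_sum _ fun _ _ => measurable_twoGroupPMF hf hg _ _ _

theorem twoGroupPMF_one_one (a b l : ℕ) :
    twoGroupPMF 1 1 a b l = if l = a + b then 1 else 0 := by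
  simp [twoGroupPMF, ← pow_add, Polynomial.coeff_X_pow]

theorem twoGroupTail_one_one_add (a b : ℕ) {m : ℕ} (hm : 1 ≤ m) (hm' : m ≤ a + b + 1) :
    twoGroupTail 1 1 a b m + twoGroupPMF 1 1 a b (m - 1) = 1 := by
  rw [add_comm, ← twoGroupTail_pred _ _ hm hm', twoGroupTail]
  simp only [twoGroupPMF_one_one]
  rw [Finset.sum_ite_eq', if_pos]
  simp only [Finset.mem_Icc]
  omega

variable {Ω : Type*} [MeasurableSpace Ω] {ν : Measure Ω} [IsProbabilityMeasure ν]
  {C : ℝ → ℝ → ℝ} {y : ℝ} {a b : ℕ} {W₁ : Fin a → Ω → ℝ} {W₂ : Fin b → Ω → ℝ}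

omit [MeasurableSpace Ω] in
theorem countIn_eq_ncard (x : ℝ) (ω : Ω) :
    countIn W₁ W₂ x ω = {i | Sum.elim W₁ W₂ i ω ∈ Icc 0 x}.ncard := by
  classical
  have h : {i | Sum.elim W₁ W₂ i ω ∈ Icc 0 x} =
      ↑(Finset.univ.filter fun i => Sum.elim W₁ W₂ i ω ∈ Icc 0 x) := by ext; simp
  rw [h, Set.ncard_coe_finset, Finset.card_filter, Fintype.sum_sum_type, countIn]
  simp only [indicator_apply, Sum.elim_inl, Sum.elim_inr]
  congr!

/-- Bridges the count over `[0,x]` and the distribution function, which measures `(-∞,x]`. For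
conditional samples the hypothesis comes from `C 0 y = 0`. -/
theorem real_mem_Icc_of_real_nonpos_eq_zero {W : Ω → ℝ} (h0 : ν.real {ω | W ω ≤ 0} = 0) (x : ℝ) :
    ν.real {ω | W ω ∈ Icc 0 x} = ν.real {ω | W ω ≤ x} := by
  refine measureReal_congr (Filter.eventuallyEq_set.2 ?_)
  have : ∀ᵐ ω ∂ν, ¬ W ω ≤ 0 := by
    rw [ae_iff]
    simpa only [not_not] using (measureReal_eq_zero_iff).1 h0
  filter_upwards [this] with ω hω
  exact ⟨fun h => h.2, fun h => ⟨(not_le.1 hω).le, h⟩⟩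

theorem IsConditionalSample.real_countIn_eq (hC : IsCopula C)
    (h : IsConditionalSample ν C y W₁ W₂) (hy : y ∈ Ioo (0 : ℝ) 1) {x : ℝ}
    (hx : x ∈ Icc (0 : ℝ) 1) (l : ℕ) :
    ν.real {ω | countIn W₁ W₂ x ω = l} =
      twoGroupPMF (C x y / y) ((x - C x y) / (1 - y)) a b l := by
  have hW : ∀ i, Measurable (Sum.elim W₁ W₂ i) := by
    rintro (i | i)
    exacts [h.measurable_fst i, h.measurable_snd i]
  have hp : ∀ i, ν.real (Sum.elim W₁ W₂ i ⁻¹' (Icc 0 x)) =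
      Sum.elim (fun _ => C x y / y) (fun _ => (x - C x y) / (1 - y)) i := by
    rintro (i | i)
    · refine (real_mem_Icc_of_real_nonpos_eq_zero ?_ x).trans (h.cdf_fst i x hx)
      refine (h.cdf_fst i 0 (by simp)).trans ?_
      rw [hC.zero_left y (Ioo_subset_Icc_self hy), zero_div]
    · refine (real_mem_Icc_of_real_nonpos_eq_zero ?_ x).trans (h.cdf_snd i x hx)
      refine (h.cdf_snd i 0 (by simp)).trans ?_
      rw [hC.zero_left y (Ioo_subset_Icc_self hy), sub_zero, zero_div]
  have := h.indep.real_forall_mem_and_ncard_eq hW (E := fun _ => univ) (A := fun _ => Icc 0 x)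
    (fun _ => MeasurableSet.univ) (fun _ => measurableSet_Icc) l
  simp only [mem_univ, implies_true, true_and, univ_inter, ← compl_eq_univ_sdiff,
    preimage_compl] at this
  rw [twoGroupPMF_eq_coeff_prod]
  simp_rw [countIn_eq_ncard]
  rw [this]
  congr 1
  refine Finset.prod_congr rfl fun i _ => ?_
  rw [probReal_compl_eq_one_sub (hW i measurableSet_Icc), hp]

theorem IsConditionalSample.real_le_countIn (hC : IsCopula C)
    (h : IsConditionalSample ν C y W₁ W₂) (hy : y ∈ Ioo (0 : ℝ) 1) {x : ℝ}
    (hx : x ∈ Icc (0 : ℝ) 1) (m : ℕ) :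
    ν.real {ω | m ≤ countIn W₁ W₂ x ω} =
      twoGroupTail (C x y / y) ((x - C x y) / (1 - y)) a b m := by
  have hW : ∀ i, Measurable (Sum.elim W₁ W₂ i) := by
    rintro (i | i)
    exacts [h.measurable_fst i, h.measurable_snd i]
  have := real_and_le_eq_sum (ν := ν) (P := fun _ => True) (f := countIn W₁ W₂ x) (N := a + b)
    ?_ ?_ m
  · simp only [true_and, h.real_countIn_eq hC hy hx] at this
    exact this
  · intro ω
    rw [countIn_eq_ncard]
    refine (Set.ncard_le_card _).trans_eq ?_
    simp
  · intro l
    simp only [true_and, countIn_eq_ncard]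
    exact measurableSet_ncard_eq (A := fun i => Sum.elim W₁ W₂ i ⁻¹' Icc 0 x)
      (fun i => hW i measurableSet_Icc) l

end BernoulliSums

/-! ### Existence of the auxiliary variables -/

section ConditionalSample

open Set

variable {Ω : Type*} [MeasurableSpace Ω] {μ : Measure Ω} [IsProbabilityMeasure μ] {U V : Ω → ℝ}
  {C : ℝ → ℝ → ℝ}

theorem FollowsCopula.cond_real_fst_le (hC : IsCopula C) (h : FollowsCopula μ U V C)
    (hU : Measurable U) (hV : Measurable V) {u y : ℝ} (hu : u ∈ Icc (0 : ℝ) 1)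
    (hy : y ∈ Icc (0 : ℝ) 1) :
    (cond μ {ω | V ω ≤ y}).real {ω | U ω ≤ u} = C u y / y ∧
      (cond μ {ω | y < V ω}).real {ω | U ω ≤ u} = (u - C u y) / (1 - y) := by
  constructor
  · rw [measureReal_def, cond_apply (measurableSet_le hV measurable_const), ENNReal.toReal_mul,
      ENNReal.toReal_inv, ← measureReal_def, ← measureReal_def, h.real_snd_le hC hU hV hy,
      ← h u hu y hy, div_eq_inv_mul]
    congr 2
    ext; simp [and_comm]
  · rw [measureReal_def, cond_apply (measurableSet_lt measurable_const hV), ENNReal.toReal_mul,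
      ENNReal.toReal_inv, ← measureReal_def, ← measureReal_def, h.real_snd_gt hC hU hV hy,
      ← h.real_fst_le_inter_snd_gt hC hU hV hu hy, div_eq_inv_mul]
    congr 2
    ext; simp [and_comm]

theorem FollowsCopula.exists_isConditionalSample (hC : IsCopula C) (h : FollowsCopula μ U V C)
    (hU : Measurable U) (hV : Measurable V) {y : ℝ} (hy : y ∈ Ioo (0 : ℝ) 1) (a b : ℕ) :
    ∃ (Ω' : Type) (_ : MeasurableSpace Ω') (ν : Measure Ω') (W₁ : Fin a → Ω' → ℝ)
      (W₂ : Fin b → Ω' → ℝ), IsProbabilityMeasure ν ∧ IsConditionalSample ν C y W₁ W₂ := by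
  have hyI := Ioo_subset_Icc_self hy
  have hle : μ {ω | V ω ≤ y} ≠ 0 := by
    intro h0
    have := h.real_snd_le hC hU hV hyI
    rw [measureReal_def, h0, ENNReal.toReal_zero] at this
    exact hy.1.ne this
  have hgt : μ {ω | y < V ω} ≠ 0 := by
    intro h0
    have := h.real_snd_gt hC hU hV hyI
    rw [measureReal_def, h0, ENNReal.toReal_zero] at this
    linarith [hy.2]
  -- The variables are the coordinates under a product of the two conditional laws of `U`.
  let ρ : Fin a ⊕ Fin b → Measure ℝ := Sum.elim (fun _ => (cond μ {ω | V ω ≤ y}).map U)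
    (fun _ => (cond μ {ω | y < V ω}).map U)
  have : IsProbabilityMeasure (cond μ {ω | V ω ≤ y}) := cond_isProbabilityMeasure hle
  have : IsProbabilityMeasure (cond μ {ω | y < V ω}) := cond_isProbabilityMeasure hgt
  have hρ : ∀ i, IsProbabilityMeasure (ρ i) := by
    rintro (i | i) <;> exact Measure.isProbabilityMeasure_map hU.aemeasurable
  have heval : ∀ i u, (Measure.pi ρ).real {w | w i ≤ u} = (ρ i).real (Iic u) := fun i u =>
    (measurePreserving_eval ρ i).measureReal_preimage measurableSet_Iic.nullMeasurableSet
  refine ⟨Fin a ⊕ Fin b → ℝ, inferInstance, Measure.pi ρ, fun i w => w (Sum.inl i),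
    fun i w => w (Sum.inr i), inferInstance, fun i => measurable_pi_apply _,
    fun i => measurable_pi_apply _, ?_, fun i u hu => ?_, fun i u hu => ?_⟩
  · convert iIndepFun_pi (μ := ρ) (X := fun _ => id) (fun _ => aemeasurable_id) using 1
    ext i w
    rcases i with i | i <;> rfl
  · rw [heval]
    refine (map_measureReal_apply hU measurableSet_Iic).trans ?_
    exact (h.cond_real_fst_le hC hU hV hu hyI).1
  · rw [heval]
    refine (map_measureReal_apply hU measurableSet_Iic).trans ?_
    exact (h.cond_real_fst_le hC hU hV hu hyI).2

end ConditionalSample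

/-! ### Measurability and identification of the conditional distribution -/

section ConditionalLaw

open Set

variable {C : ℝ → ℝ → ℝ}

/-- The extension of a function on the unit square that is constant along the normals. -/
noncomputable def clampSquare (C : ℝ → ℝ → ℝ) (x y : ℝ) : ℝ :=
  C (max 0 (min 1 x)) (max 0 (min 1 y))

theorem clampSquare_of_mem {x y : ℝ} (hx : x ∈ Icc (0 : ℝ) 1) (hy : y ∈ Icc (0 : ℝ) 1) :
    clampSquare C x y = C x y := by
  rw [clampSquare, min_eq_right hx.2, max_eq_right hx.1, min_eq_right hy.2, max_eq_right hy.1]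

theorem clampSquare_eventuallyEq {x y : ℝ} (hx : x ∈ Icc (0 : ℝ) 1) (hy : y ∈ Ioo (0 : ℝ) 1) :
    clampSquare C x =ᶠ[nhds y] C x := by
  filter_upwards [Icc_mem_nhds hy.1 hy.2] with v hv
  exact clampSquare_of_mem hx hv

/-- `C` is arbitrary off the unit square, while measurability of the derivative in both variables is
obtained from continuity on the whole plane; hence the clamped extension. -/
theorem IsCopula.continuous_clampSquare (hC : IsCopula C) :
    Continuous (Function.uncurry (clampSquare C)) := by
  refine hC.continuousOn_uncurry.comp_continuous
    (f := fun p : ℝ × ℝ => (max 0 (min 1 p.1), max 0 (min 1 p.2))) (by fun_prop) fun p => ?_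
  simp

theorem orderStatCondCDF_clampSquare {x y : ℝ} (hx : x ∈ Icc (0 : ℝ) 1) (hy : y ∈ Ioo (0 : ℝ) 1)
    (a b m : ℕ) : orderStatCondCDF (clampSquare C) a b m x y = orderStatCondCDF C a b m x y := by
  rw [orderStatCondCDF, orderStatCondCDF, clampSquare_of_mem hx (Ioo_subset_Icc_self hy),
    (clampSquare_eventuallyEq hx hy).deriv_eq]

theorem measurable_orderStatCondCDF (hC : Continuous (Function.uncurry C)) (a b m : ℕ) :
    Measurable fun p : ℝ × ℝ => orderStatCondCDF C a b m p.1 p.2 := by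
  have h1 : Measurable fun p : ℝ × ℝ => C p.1 p.2 := hC.measurable
  have h2 : Measurable fun p : ℝ × ℝ => C p.1 p.2 / p.2 := h1.div measurable_snd
  have h3 : Measurable fun p : ℝ × ℝ => (p.1 - C p.1 p.2) / (1 - p.2) :=
    (measurable_fst.sub h1).div (measurable_const.sub measurable_snd)
  exact (measurable_twoGroupTail h2 h3 a b m).add
    ((measurable_deriv_with_param hC).mul (measurable_twoGroupPMF h2 h3 a b (m - 1)))

theorem IsCopula.orderStatCondCDF_nonneg (hC : IsCopula C) {x y : ℝ} (hx : x ∈ Icc (0 : ℝ) 1)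
    (hy : y ∈ Ioo (0 : ℝ) 1) (a b m : ℕ) : 0 ≤ orderStatCondCDF C a b m x y := by
  have hyI := Ioo_subset_Icc_self hy
  have h0 : (0 : ℝ) ∈ Icc (0 : ℝ) 1 := by simp
  have h1 : (1 : ℝ) ∈ Icc (0 : ℝ) 1 := by simp
  have e0 := hC.zero_right x hx
  have e1 := hC.one_right x hx
  have a1 := hC.mono_right hx h0 hyI hyI.1
  have a2 := hC.sub_le_right hx h0 hyI hyI.1
  have a3 := hC.mono_right hx hyI h1 hyI.2
  have a4 := hC.sub_le_right hx hyI h1 hyI.2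
  have hy1 : 0 < 1 - y := sub_pos.2 hy.2
  have hp : C x y / y ∈ Icc (0 : ℝ) 1 :=
    ⟨div_nonneg (by linarith) hy.1.le, (div_le_one hy.1).2 (by linarith)⟩
  have hq : (x - C x y) / (1 - y) ∈ Icc (0 : ℝ) 1 :=
    ⟨div_nonneg (by linarith) hy1.le, (div_le_one hy1).2 (by linarith)⟩
  exact add_nonneg (twoGroupTail_nonneg hp hq _ _ _)
    (mul_nonneg (hC.deriv_nonneg hx hy) (twoGroupPMF_nonneg hp hq _ _ _))

/-- At `x = 1` both success probabilities and the derivative are 1, so S is the constant `a + b`. -/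
theorem IsCopula.orderStatCondCDF_one (hC : IsCopula C) {y : ℝ} (hy : y ∈ Ioo (0 : ℝ) 1)
    {a b m : ℕ} (hm : 1 ≤ m) (hm' : m ≤ a + b + 1) : orderStatCondCDF C a b m 1 y = 1 := by
  have hd : deriv (C 1) y = 1 := by
    have : C 1 =ᶠ[nhds y] id := by
      filter_upwards [Icc_mem_nhds hy.1 hy.2] with v hv
      exact hC.one_left v hv
    rw [this.deriv_eq, deriv_id]
  rw [orderStatCondCDF, hd, hC.one_left y (Ioo_subset_Icc_self hy), div_self hy.1.ne',
    div_self (sub_pos.2 hy.2).ne', one_mul, twoGroupTail_one_one_add a b hm hm']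

/-- The density of the `k`-th order statistic of `N + 1` independent uniform variables. -/
noncomputable def orderStatDensity (N k : ℕ) (v : ℝ) : ENNReal :=
  (N + 1 : ℕ) * ENNReal.ofReal (N.choose (k - 1) * (v ^ (k - 1) * (1 - v) ^ (N - (k - 1))))

theorem measurable_orderStatDensity (N k : ℕ) : Measurable (orderStatDensity N k) := by
  unfold orderStatDensity
  fun_prop

theorem orderStatDensity_ne_zero {N k : ℕ} (hk : k ≤ N + 1) {v : ℝ} (hv : v ∈ Ioo (0 : ℝ) 1) :
    orderStatDensity N k v ≠ 0 := by
  have h1 : 0 < 1 - v := sub_pos.2 hv.2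
  have h2 := hv.1
  have h3 : 0 < N.choose (k - 1) := Nat.choose_pos (by omega)
  refine mul_ne_zero (by simp) (ENNReal.ofReal_pos.2 ?_).ne'
  positivity

theorem orderStatDensity_ne_top (N k : ℕ) (v : ℝ) : orderStatDensity N k v ≠ ⊤ :=
  ENNReal.mul_ne_top (by simp) ENNReal.ofReal_ne_top

variable {Ω : Type*} [MeasurableSpace Ω] {μ : Measure Ω} [IsProbabilityMeasure μ] {N : ℕ}
  {U V : Fin (N + 1) → Ω → ℝ}

theorem measure_orderStat_mem_and_le_eq_setLIntegral (hC : IsCopula C)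
    (hU : ∀ i, Measurable (U i)) (hV : ∀ i, Measurable (V i))
    (hindep : iIndepFun (fun i ω => (U i ω, V i ω)) μ)
    (hlaw : ∀ i, FollowsCopula μ (U i) (V i) C) {x : ℝ} (hx : x ∈ Icc (0 : ℝ) 1)
    {k m : ℕ} (hk : 1 ≤ k ∧ k ≤ N + 1) (hm : 1 ≤ m ∧ m ≤ N + 1) {B : Set ℝ}
    (hB : MeasurableSet B) :
    μ {ω | orderStat (fun i => V i ω) k hk ∈ B ∧ orderStat (fun i => U i ω) m hm ≤ x} =
      ∫⁻ v in B, orderStatDensity N k v *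
        ENNReal.ofReal (orderStatCondCDF C (k - 1) (N - (k - 1)) m x v)
          ∂(volume.restrict (Ioo 0 1)) := by
  rw [measure_orderStat_mem_and_orderStat_le hC hU hV hindep hlaw hx hk hm hB,
    ← lintegral_indicator hB, ← lintegral_const_mul' _ _ (by simp)]
  refine setLIntegral_congr_fun measurableSet_Ioo fun v hv => ?_
  have h1 : 0 ≤ 1 - v := sub_nonneg.2 hv.2.le
  have h2 := hv.1
  by_cases hvB : v ∈ B
  · simp only [indicator_of_mem hvB]
    rw [ENNReal.ofReal_mul (by positivity), orderStatDensity, mul_assoc]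
  · simp [hvB]

/-- The marginal law is read off the joint law by taking `m = 1` and `x = 1`, which makes the event
on the first coordinates almost sure. -/
theorem map_orderStat_eq_withDensity (hC : IsCopula C)
    (hU : ∀ i, Measurable (U i)) (hV : ∀ i, Measurable (V i))
    (hindep : iIndepFun (fun i ω => (U i ω, V i ω)) μ)
    (hlaw : ∀ i, FollowsCopula μ (U i) (V i) C) {k : ℕ} (hk : 1 ≤ k ∧ k ≤ N + 1) :
    μ.map (fun ω => orderStat (fun i => V i ω) k hk) =
      (volume.restrict (Ioo 0 1)).withDensity (orderStatDensity N k) := by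
  ext B hB
  have hm : 1 ≤ 1 ∧ 1 ≤ N + 1 := by omega
  rw [Measure.map_apply (measurable_orderStat hV hk) hB, withDensity_apply _ hB]
  trans μ {ω | orderStat (fun i => V i ω) k hk ∈ B ∧ orderStat (fun i => U i ω) 1 hm ≤ 1}
  · refine measure_congr (Filter.eventuallyEq_set.2 ?_)
    filter_upwards [ae_all_iff.2 fun i => (hlaw i).ae_le_one hC (hU i) (hV i)] with ω hω
    obtain ⟨i, hi⟩ := exists_orderStat_eq (fun i => U i ω) hm
    simp [hi, (hω i).1]
  · rw [measure_orderStat_mem_and_le_eq_setLIntegral hC hU hV hindep hlaw (by simp) hk hm hB,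
      Measure.restrict_restrict hB]
    refine setLIntegral_congr_fun (hB.inter measurableSet_Ioo) fun v hv => ?_
    rw [hC.orderStatCondCDF_one hv.2 le_rfl (by omega), ENNReal.ofReal_one, mul_one]

/-- For fixed `x`, the conditional distribution function of an order statistic. -/
theorem ae_condDistrib_orderStat_real_Iic (hC : IsCopula C)
    (hU : ∀ i, Measurable (U i)) (hV : ∀ i, Measurable (V i))
    (hindep : iIndepFun (fun i ω => (U i ω, V i ω)) μ)
    (hlaw : ∀ i, FollowsCopula μ (U i) (V i) C) {x : ℝ} (hx : x ∈ Icc (0 : ℝ) 1)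
    {k m : ℕ} (hk : 1 ≤ k ∧ k ≤ N + 1) (hm : 1 ≤ m ∧ m ≤ N + 1) :
    ∀ᵐ y ∂(volume.restrict (Ioo 0 1)),
      (condDistrib (fun ω => orderStat (fun i => U i ω) m hm)
        (fun ω => orderStat (fun i => V i ω) k hk) μ y).real (Iic x) =
      orderStatCondCDF C (k - 1) (N - (k - 1)) m x y := by
  set X := fun ω => orderStat (fun i => U i ω) m hm with hX
  set Y := fun ω => orderStat (fun i => V i ω) k hk with hY
  have hXm : Measurable X := measurable_orderStat hU hm
  have hYm : Measurable Y := measurable_orderStat hV hk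
  set κ := condDistrib X Y μ with hκ
  have hκm : Measurable fun y => κ y (Iic x) := Kernel.measurable_coe κ measurableSet_Iic
  have hDm := measurable_orderStatDensity N k
  have hHm : AEMeasurable (fun v => orderStatCondCDF C (k - 1) (N - (k - 1)) m x v)
      (volume.restrict (Ioo 0 1)) := by
    have hm := (measurable_orderStatCondCDF hC.continuous_clampSquare (k - 1) (N - (k - 1))
      m).comp (measurable_prodMk_left (x := x))
    refine ⟨_, hm, ?_⟩
    exact ae_restrict_of_forall_mem measurableSet_Ioo fun v hv =>
      (orderStatCondCDF_clampSquare hx hv _ _ _).symm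
  -- Over every Borel set `B` both sides integrate to the same joint probability: the left by
  -- disintegration, the right by the joint law.
  have hae : (fun y => orderStatDensity N k y * κ y (Iic x)) =ᵐ[volume.restrict (Ioo 0 1)]
      fun y => orderStatDensity N k y *
        ENNReal.ofReal (orderStatCondCDF C (k - 1) (N - (k - 1)) m x y) := by
    refine ae_eq_of_forall_setLIntegral_eq_of_sigmaFinite₀ (hDm.mul hκm).aemeasurable
      (hDm.aemeasurable.mul hHm.ennreal_ofReal) fun B hB _ => ?_
    rw [← measure_orderStat_mem_and_le_eq_setLIntegral hC hU hV hindep hlaw hx hk hm hB]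
    have h1 := setLIntegral_preimage_condDistrib (μ := μ) hYm hXm.aemeasurable
      (measurableSet_Iic (a := x)) hB
    rw [← setLIntegral_map hB hκm hYm, hY,
      map_orderStat_eq_withDensity hC hU hV hindep hlaw hk,
      setLIntegral_withDensity_eq_setLIntegral_mul _ hDm hκm hB] at h1
    exact h1
  filter_upwards [hae, ae_restrict_mem measurableSet_Ioo] with y hy hyI
  -- The density is positive and finite on `(0,1)`, so it cancels.
  have := (ENNReal.mul_right_inj (orderStatDensity_ne_zero hk.2 hyI)
    (orderStatDensity_ne_top N k y)).1 hy
  rw [measureReal_def, this, ENNReal.toReal_ofReal (hC.orderStatCondCDF_nonneg hx hyI _ _ _)]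

/-- Needed for Fubini: statements for every `x` and almost every `y` yield one for almost every pair
only if the good set is jointly measurable. -/
theorem measurableSet_condDistrib_real_Iic_eq (hC : IsCopula C) (κ : Kernel ℝ ℝ)
    [IsMarkovKernel κ] (a b m : ℕ) :
    MeasurableSet {p : ℝ × ℝ | p.1 ∈ Icc (0 : ℝ) 1 ∧ p.2 ∈ Ioo (0 : ℝ) 1 ∧
      DifferentiableAt ℝ (C p.1) p.2 ∧
      (κ p.2).real (Iic p.1) = orderStatCondCDF C a b m p.1 p.2} := by
  have hcont := hC.continuous_clampSquare
  have hset : {p : ℝ × ℝ | p.1 ∈ Icc (0 : ℝ) 1 ∧ p.2 ∈ Ioo (0 : ℝ) 1 ∧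
      DifferentiableAt ℝ (C p.1) p.2 ∧
      (κ p.2).real (Iic p.1) = orderStatCondCDF C a b m p.1 p.2} =
      (Icc 0 1 ×ˢ Ioo 0 1) ∩ ({p | DifferentiableAt ℝ (clampSquare C p.1) p.2} ∩
        {p | (κ p.2).real (Iic p.1) = orderStatCondCDF (clampSquare C) a b m p.1 p.2}) := by
    ext p
    simp only [mem_ofPred_eq, mem_inter_iff, mem_prod]
    rw [and_assoc]
    refine and_congr_right fun hx => and_congr_right fun hy => ?_
    rw [orderStatCondCDF_clampSquare hx hy, (clampSquare_eventuallyEq hx hy).differentiableAt_iff]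
  have hker : Measurable fun p : ℝ × ℝ => (κ p.2).real (Iic p.1) := by
    have hm : MeasurableSet {q : (ℝ × ℝ) × ℝ | q.2 ≤ q.1.1} :=
      measurableSet_le measurable_snd measurable_fst.fst
    exact (Kernel.measurable_kernel_prodMk_left
      (κ := κ.comap (Prod.snd : ℝ × ℝ → ℝ) measurable_snd) hm).ennreal_toReal
  rw [hset]
  exact (measurableSet_Icc.prod measurableSet_Ioo).inter
    ((measurableSet_of_differentiableAt_with_param ℝ hcont).inter
      (measurableSet_eq_fun hker (measurable_orderStatCondCDF hcont _ _ _)))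

end ConditionalLaw

/-! ### Assembly of the theorem -/

theorem lemma2p2 {Ω : Type*} [MeasurableSpace Ω] (μ : Measure Ω) [IsProbabilityMeasure μ]
    (C : ℝ → ℝ → ℝ) (hC : IsCopula C) (n : ℕ) (U V : Fin n → Ω → ℝ)
    (hU : ∀ i, Measurable (U i)) (hV : ∀ i, Measurable (V i))
    (hindep : iIndepFun (fun i ω => (U i ω, V i ω)) μ)
    (hlaw : ∀ i, FollowsCopula μ (U i) (V i) C)
    (k m : ℕ) (hk : 1 ≤ k ∧ k ≤ n) (hm : 1 ≤ m ∧ m ≤ n) :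
    -- the two distribution functions are the conditional ones of `U` given `V ≤ y` and `V > y`
    (∀ y ∈ Set.Ioo (0 : ℝ) 1, ∀ i, ∀ u ∈ Set.Icc (0 : ℝ) 1,
      (cond μ {ω | V i ω ≤ y}).real {ω | U i ω ≤ u} = C u y / y ∧
      (cond μ {ω | y < V i ω}).real {ω | U i ω ≤ u} = (u - C u y) / (1 - y)) ∧
    -- the auxiliary random variables exist
    (∀ y ∈ Set.Ioo (0 : ℝ) 1, ∃ (Ω' : Type) (_ : MeasurableSpace Ω') (ν : Measure Ω')
      (W₁ : Fin (k - 1) → Ω' → ℝ) (W₂ : Fin (n - k) → Ω' → ℝ),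
      IsProbabilityMeasure ν ∧ IsConditionalSample ν C y W₁ W₂) ∧
    -- the conditional distribution function, at all points of a set `G` of full measure
    ∃ G : Set (ℝ × ℝ),
      (∀ x ∈ Set.Icc (0 : ℝ) 1, ∀ᵐ y ∂(volume.restrict (Set.Icc (0 : ℝ) 1)), (x, y) ∈ G) ∧
      (∀ᵐ p ∂(volume.restrict (Set.Icc (0 : ℝ) 1 ×ˢ Set.Icc (0 : ℝ) 1)), p ∈ G) ∧
      ∀ x y : ℝ, (x, y) ∈ G →
        DifferentiableAt ℝ (fun v => C x v) y ∧
        ∀ (Ω' : Type*) [MeasurableSpace Ω'] (ν : Measure Ω') [IsProbabilityMeasure ν]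
          (W₁ : Fin (k - 1) → Ω' → ℝ) (W₂ : Fin (n - k) → Ω' → ℝ),
          IsConditionalSample ν C y W₁ W₂ →
          (condDistrib (fun ω => orderStat (fun i => U i ω) m hm)
              (fun ω => orderStat (fun i => V i ω) k hk) μ y).real (Set.Iic x) =
            ν.real {ω | m ≤ countIn W₁ W₂ x ω} +
              deriv (fun v => C x v) y * ν.real {ω | countIn W₁ W₂ x ω = m - 1} := by

  refine ⟨fun y hy i u hu => (hlaw i).cond_real_fst_le hC (hU i) (hV i) hu
    (Set.Ioo_subset_Icc_self hy), fun y hy => (hlaw ⟨0, by omega⟩).exists_isConditionalSample hC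
    (hU _) (hV _) hy _ _, ?_⟩
  obtain ⟨N, rfl⟩ : ∃ N, n = N + 1 := ⟨n - 1, by omega⟩
  have hb : N + 1 - k = N - (k - 1) := by omega
  have hIoo : volume.restrict (Set.Icc (0 : ℝ) 1) = volume.restrict (Set.Ioo 0 1) :=
    Measure.restrict_congr_set Ioo_ae_eq_Icc.symm
  set κ := condDistrib (fun ω => orderStat (fun i => U i ω) m hm)
    (fun ω => orderStat (fun i => V i ω) k hk) μ with hκ
  -- This set serves as `G`. It is defined through `orderStatCondCDF`, not through a particular
  -- sample, so it works for all realisations of the auxiliary variables at once.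
  have hG : ∀ x ∈ Set.Icc (0 : ℝ) 1, ∀ᵐ y ∂(volume.restrict (Set.Icc (0 : ℝ) 1)),
      (x, y) ∈ {p : ℝ × ℝ | p.1 ∈ Set.Icc (0 : ℝ) 1 ∧ p.2 ∈ Set.Ioo (0 : ℝ) 1 ∧
        DifferentiableAt ℝ (C p.1) p.2 ∧
        (κ p.2).real (Set.Iic p.1) = orderStatCondCDF C (k - 1) (N - (k - 1)) m p.1 p.2} := by
    intro x hx
    rw [hIoo]
    filter_upwards [ae_condDistrib_orderStat_real_Iic hC hU hV hindep hlaw hx hk hm,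
      hC.ae_differentiableAt_right hx, ae_restrict_mem measurableSet_Ioo] with y h1 h2 h3
    exact ⟨hx, h3, h2, h1⟩
  refine ⟨_, hG, ?_, ?_⟩
  · rw [Measure.volume_eq_prod, ← Measure.prod_restrict,
      Measure.ae_prod_iff_ae_ae (p := fun p => p ∈ {p : ℝ × ℝ | p.1 ∈ Set.Icc (0 : ℝ) 1 ∧
        p.2 ∈ Set.Ioo (0 : ℝ) 1 ∧ DifferentiableAt ℝ (C p.1) p.2 ∧
        (κ p.2).real (Set.Iic p.1) = orderStatCondCDF C (k - 1) (N - (k - 1)) m p.1 p.2})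
        (measurableSet_condDistrib_real_Iic_eq hC κ _ _ _)]
    exact ae_restrict_of_forall_mem measurableSet_Icc hG
  · rintro x y ⟨hx, hy, hd, h⟩
    refine ⟨hd, fun Ω' _ ν _ W₁ W₂ hW => ?_⟩
    rw [hW.real_le_countIn hC hy hx, hW.real_countIn_eq hC hy hx, hb]
    exact h
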